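/- Let $\mathbb K\in\{\mathbb R,\mathbb C\}$. Let $\mathcal H$ be a graded and connected Hopf algebra over $\mathbb K$, i.e. $\mathcal H=\bigoplus_{n\ge 0}\mathcal H_n$ with $\mathcal H_m\mathcal H_n\subseteq\mathcal H_{m+n}$, $\Delta(\mathcal H_n)\subseteq\bigoplus_{k+l=n}\mathcal H_k\otimes\mathcal H_l$ and $\mathcal H_0\cong\mathbb K$, and let $B$ be a commutative unital locally convex algebra over $\mathbb K$, i.e. a commutative unital $\mathbb K$-algebra with a Hausdorff locally convex vector space topology such that the multiplication $B\times B\to B$ is continuous. Let $G=\mathrm{Char}(\mathcal H,B)$ be the group of unital algebra homomorphisms $\mathcal H\to B$ under convolution $\phi\star\psi=\mu_B\circ(\phi\otimes\psi)\circ\Delta$, and let $\mathfrak g(\mathcal H,B)$ be the space of infinitesimal characters, i.e. of the linear maps $\phi:\mathcal H\to B$ with $\phi(ab)=\phi(a)\epsilon(b)+\epsilon(a)\phi(b)$ for all $a,b\in\mathcal H$; both carry the topology of pointwise convergence. Differentiability ($C^r_{\mathbb K}$, $r\in\mathbb N_0\cup\{\infty\}$) between locally convex spaces is understood in the sense of Bastiani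 (the iterated directional derivatives exist and are jointly continuous); a map is $\mathbb C$-analytic if it is $C^\infty_{\mathbb C}$, and $\mathbb R$-analytic if it extends to a $C^\infty_{\mathbb C}$-map on an open neighbourhood of its domain in the complexification. Then $\exp(\psi)=\sum_{k\ge 0}\frac{1}{k!}\psi^{\star k}$ (pointwise convergence) defines a homeomorphism $\exp:\mathfrak g(\mathcal H,B)\to G$, and for the manifold structure on $G$ given by the single global chart $\exp^{-1}$ the following hold. 1. $G$ is a BCH-Lie group over $\mathbb K$: it is a $\mathbb K$-analytic Lie group (the manifold structure and the group operations are smooth and $\mathbb K$-analytic), it has a smooth Lie group exponential map $\exp_G:T_1G\to G$, and $\exp_G$ restricts to a smooth diffeomorphism and to a $\mathbb K$-analytic diffeomorphism from an open neighbourhood of $0$ onto an open neighbourhood of the unit. 2. Under the identification $T_1G\cong\mathfrak g(\mathcal H,B)$ given by the chart $\exp^{-1}$, the Lie group exponential map $\exp_G$ is $\exp$, and it is a $\mathbb K$-analytic diffeomorphism from $\mathfrak g(\mathcal H,B)$ onto $G$. Here $\exp_G$ is the Lie group exponential map if for each $v\in T_1G$ there is a smooth one-parameter subgroup $\gamma:\mathbb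 R\to G$ with $\gamma'(0)=v$, and each such $\gamma$ satisfies $\gamma(1)=\exp_G(v)$. -/

import Mathlib

open Set Filter Topology
open scoped ContDiff TensorProduct

/-! ### Graded connected Hopf algebras, characters, infinitesimal characters -/

section Hopf

variable {𝕜 H : Type*} [Field 𝕜] [Ring H] [HopfAlgebra 𝕜 H]

/-- The submodules `𝒜 n` are the homogeneous components of an `ℕ`-grading of the Hopf algebra `H`
which is compatible with product and coproduct and which is connected, i.e. `𝒜 0 ≅ 𝕜`. -/
structure IsConnectedHopfGrading (𝒜 : ℕ → Submodule 𝕜 H) : Prop where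
  isInternal : DirectSum.IsInternal 𝒜
  mul_mem : ∀ m n : ℕ, ∀ a ∈ 𝒜 m, ∀ b ∈ 𝒜 n, a * b ∈ 𝒜 (m + n)
  comul_mem : ∀ n : ℕ, ∀ a ∈ 𝒜 n, Coalgebra.comul (R := 𝕜) a ∈
    ⨆ p ∈ Finset.HasAntidiagonal.antidiagonal n,
      LinearMap.range (TensorProduct.map (𝒜 p.1).subtype (𝒜 p.2).subtype)
  connected : Nonempty (𝒜 0 ≃ₗ[𝕜] 𝕜)

variable (𝕜 H) (B : Type*) [CommRing B] [Algebra 𝕜 B]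

/-- The space of `B`-valued infinitesimal characters of `H`, i.e. of the linear maps `φ` with
`φ (a b) = φ a ε(b) + ε(a) φ b`. -/
def InfChar : Submodule 𝕜 (H →ₗ[𝕜] B) where
  carrier := {φ | ∀ a b : H, φ (a * b) =
    Coalgebra.counit (R := 𝕜) b • φ a + Coalgebra.counit (R := 𝕜) a • φ b}
  zero_mem' := by intro a b; simp
  add_mem' := by
    intro φ ψ hφ hψ a b
    simp only [LinearMap.add_apply, hφ a b, hψ a b, smul_add]
    abel
  smul_mem' := by
    intro c φ hφ a b
    simp only [LinearMap.smul_apply, hφ a b, smul_add, smul_comm c]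

/-- The `B`-valued characters of `H`, i.e. the unital algebra homomorphisms `H → B`. The product on
`WithConv (H →ₐ[𝕜] B)` is the convolution `φ ⋆ ψ = μ_B ∘ (φ ⊗ ψ) ∘ Δ`. -/
abbrev CharGroup : Type _ := WithConv (H →ₐ[𝕜] B)

variable {𝕜 H B}

/-- The inverse `φ ∘ S` of a character with respect to convolution. -/
noncomputable def charInv (φ : CharGroup 𝕜 H B) : CharGroup 𝕜 H B :=
  WithConv.toConv <| AlgHom.ofLinearMap
    (φ.ofConv.toLinearMap ∘ₗ HopfAlgebra.antipode 𝕜 (A := H))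
    (by simp)
    (fun a b => by
      simp [HopfAlgebra.antipode_mul_antidistrib, mul_comm])

/-- The characters form a group under convolution. -/
noncomputable instance charGroup : Group (CharGroup 𝕜 H B) where
  inv := charInv
  inv_mul_cancel φ := by
    apply WithConv.ofConv_injective
    apply AlgHom.toLinearMap_injective
    apply WithConv.toConv_injective
    change WithConv.toConv (φ.ofConv.toLinearMap ∘ₗ HopfAlgebra.antipode 𝕜 (A := H)) *
      WithConv.toConv φ.ofConv.toLinearMap = 1
    ext a
    rw [(Coalgebra.Repr.arbitrary 𝕜 a).convMul_apply]
    have h := congrArg φ.ofConv (HopfAlgebra.sum_antipode_mul_eq_algebraMap_counit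
      (Coalgebra.Repr.arbitrary 𝕜 a))
    simpa using h

/-- The topology of pointwise convergence on `Hom(H, B)`, and hence on infinitesimal characters. -/
instance homPointwiseTopology [TopologicalSpace B] : TopologicalSpace (H →ₗ[𝕜] B) :=
  TopologicalSpace.induced (fun φ (h : H) => φ h) inferInstance

/-- The topology of pointwise convergence on the character group. -/
instance charPointwiseTopology [TopologicalSpace B] : TopologicalSpace (CharGroup 𝕜 H B) :=
  TopologicalSpace.induced (fun φ (h : H) => φ.ofConv h) inferInstance

end Hopf

/-! ### Differential calculus in locally convex spaces

Throughout, spaces over `𝕜 = ℝ` or `ℂ` also carry the real structure obtained by restriction of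
scalars, recorded (as usual in Mathlib) by instances `[Module ℝ E]` with `IsScalarTower ℝ 𝕜 E`. -/

section Calculus

/-- `v` is the derivative of `f` at `x` in direction `h`:
`v = lim t⁻¹ (f (x + t h) - f x)` as `t → 0` in `𝕜 \ {0}`. -/
def HasDirDeriv (𝕜 : Type*) [RCLike 𝕜] {E F : Type*} [AddCommGroup E] [Module 𝕜 E]
    [AddCommGroup F] [Module 𝕜 F] [TopologicalSpace F] (f : E → F) (x h : E) (v : F) : Prop :=
  Tendsto (fun t : 𝕜 => t⁻¹ • (f (x + t • h) - f x)) (𝓝[≠] 0) (𝓝 v)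

/-- `f` is `C^r` over `𝕜` (in the sense of Bastiani) on the open set `U`, for `r ∈ ℕ ∪ {∞}`: the
iterated directional derivatives `d k x y = (D_{y_k} ⋯ D_{y_1} f) x` exist and are continuous on
`U × E^k` for all `k ≤ r`. -/
def IsCrOn (𝕜 : Type*) [RCLike 𝕜] {E F : Type*} [AddCommGroup E] [Module 𝕜 E]
    [TopologicalSpace E] [AddCommGroup F] [Module 𝕜 F] [TopologicalSpace F]
    (r : ℕ∞) (f : E → F) (U : Set E) : Prop :=
  ∃ d : (k : ℕ) → E → (Fin k → E) → F,
    (∀ x ∈ U, ∀ y : Fin 0 → E, d 0 x y = f x) ∧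
    (∀ k : ℕ, (k : ℕ∞) < r → ∀ x ∈ U, ∀ (y : Fin k → E) (h : E),
      HasDirDeriv 𝕜 (fun z => d k z y) x h
        (d (k + 1) x (Fin.snoc (α := fun _ => E) y h))) ∧
    (∀ k : ℕ, (k : ℕ∞) ≤ r →
      ContinuousOn (fun p : E × (Fin k → E) => d k p.1 p.2) (U ×ˢ univ))

/-- The complexification `E × E` of a real topological vector space `E`; the pair `(u, v)` stands
for `u + i v`. -/
def Complexification (E : Type*) : Type _ := E × E

namespace Complexification

variable {E : Type*}

instance [AddCommGroup E] : AddCommGroup (Complexification E) :=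
  inferInstanceAs (AddCommGroup (E × E))

instance [TopologicalSpace E] : TopologicalSpace (Complexification E) :=
  inferInstanceAs (TopologicalSpace (E × E))

/-- `(x + i y) (u, v) = (x u - y v, x v + y u)`. -/
instance [AddCommGroup E] [Module ℝ E] : Module ℂ (Complexification E) where
  smul z w := (z.re • w.1 - z.im • w.2, z.re • w.2 + z.im • w.1)
  one_smul w := by
    refine Prod.ext ?_ ?_
    · change (1 : ℂ).re • w.1 - (1 : ℂ).im • w.2 = w.1
      simp
    · change (1 : ℂ).re • w.2 + (1 : ℂ).im • w.1 = w.2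
      simp
  mul_smul z z' w := by
    refine Prod.ext ?_ ?_
    · change (z * z').re • w.1 - (z * z').im • w.2 =
        z.re • (z'.re • w.1 - z'.im • w.2) - z.im • (z'.re • w.2 + z'.im • w.1)
      simp only [Complex.mul_re, Complex.mul_im]
      module
    · change (z * z').re • w.2 + (z * z').im • w.1 =
        z.re • (z'.re • w.2 + z'.im • w.1) + z.im • (z'.re • w.1 - z'.im • w.2)
      simp only [Complex.mul_re, Complex.mul_im]
      module
  smul_zero z := by
    refine Prod.ext ?_ ?_
    · change z.re • (0 : E) - z.im • (0 : E) = 0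
      simp
    · change z.re • (0 : E) + z.im • (0 : E) = 0
      simp
  smul_add z w w' := by
    refine Prod.ext ?_ ?_
    · change z.re • (w.1 + w'.1) - z.im • (w.2 + w'.2) =
        (z.re • w.1 - z.im • w.2) + (z.re • w'.1 - z.im • w'.2)
      module
    · change z.re • (w.2 + w'.2) + z.im • (w.1 + w'.1) =
        (z.re • w.2 + z.im • w.1) + (z.re • w'.2 + z.im • w'.1)
      module
  add_smul z z' w := by
    refine Prod.ext ?_ ?_
    · change (z + z').re • w.1 - (z + z').im • w.2 =
        (z.re • w.1 - z.im • w.2) + (z'.re • w.1 - z'.im • w.2)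
      simp only [Complex.add_re, Complex.add_im]
      module
    · change (z + z').re • w.2 + (z + z').im • w.1 =
        (z.re • w.2 + z.im • w.1) + (z'.re • w.2 + z'.im • w.1)
      simp only [Complex.add_re, Complex.add_im]
      module
  zero_smul w := by
    refine Prod.ext ?_ ?_
    · change (0 : ℂ).re • w.1 - (0 : ℂ).im • w.2 = 0
      simp
    · change (0 : ℂ).re • w.2 + (0 : ℂ).im • w.1 = 0
      simp

/-- The inclusion `u ↦ u + i 0` of `E` into its complexification. -/
def ofReal [Zero E] (u : E) : Complexification E := (u, 0)

end Complexification

/-- `f` is real analytic on the open set `U`: it extends to a `C^∞_ℂ`-map on an open neighbourhood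
of `U` in the complexification. -/
def IsRealAnalyticOn {E F : Type*} [AddCommGroup E] [Module ℝ E] [TopologicalSpace E]
    [AddCommGroup F] [Module ℝ F] [TopologicalSpace F] (f : E → F) (U : Set E) : Prop :=
  ∃ (V : Set (Complexification E)) (g : Complexification E → Complexification F),
    IsOpen V ∧ (∀ x ∈ U, Complexification.ofReal x ∈ V) ∧ IsCrOn ℂ ⊤ g V ∧
    ∀ x ∈ U, g (Complexification.ofReal x) = Complexification.ofReal (f x)

/-- `f` is `𝕜`-analytic on the open set `U`. The condition `RCLike.I = 0` says that `𝕜` is the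
field of real numbers; if `𝕜` is the field of complex numbers, then `𝕜`-analytic means
`C^∞` over `𝕜`. -/
def IsAnalyticLCOn (𝕜 : Type*) [RCLike 𝕜] {E F : Type*} [AddCommGroup E] [Module 𝕜 E]
    [Module ℝ E] [TopologicalSpace E] [AddCommGroup F] [Module 𝕜 F] [Module ℝ F]
    [TopologicalSpace F] (f : E → F) (U : Set E) : Prop :=
  ((RCLike.I : 𝕜) = 0 → IsRealAnalyticOn f U) ∧ ((RCLike.I : 𝕜) ≠ 0 → IsCrOn 𝕜 ⊤ f U)

/-- `f` is of class `C^r` over `𝕜` on the open set `U`, for `r ∈ ℕ ∪ {∞, ω}`. -/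
def IsOfClassOn (𝕜 : Type*) [RCLike 𝕜] {E F : Type*} [AddCommGroup E] [Module 𝕜 E]
    [Module ℝ E] [TopologicalSpace E] [AddCommGroup F] [Module 𝕜 F] [Module ℝ F]
    [TopologicalSpace F] (r : WithTop ℕ∞) (f : E → F) (U : Set E) : Prop :=
  (r = ω → IsAnalyticLCOn 𝕜 f U) ∧ ∀ k : ℕ∞, r = (k : WithTop ℕ∞) → IsCrOn 𝕜 k f U

end Calculus

/-! ### Manifolds and Lie groups modelled on locally convex spaces -/

section Manifolds

variable (𝕜 : Type*) [RCLike 𝕜]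

/-- `A` is a `C^r`-atlas of charts with values in the locally convex `𝕜`-vector space `E` on the
Hausdorff space `M`. -/
structure IsLCAtlas {E : Type*} [AddCommGroup E] [Module 𝕜 E] [Module ℝ E] [TopologicalSpace E]
    {M : Type*} [TopologicalSpace M] (r : WithTop ℕ∞) (A : Set (OpenPartialHomeomorph M E)) :
    Prop where
  isTopologicalAddGroup_model : IsTopologicalAddGroup E
  continuousSMul_model : ContinuousSMul 𝕜 E
  locallyConvexSpace_model : LocallyConvexSpace ℝ E
  t2Space_model : T2Space E
  t2Space : T2Space M
  covers : ∀ x : M, ∃ κ ∈ A, x ∈ κ.source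
  compatible : ∀ κ ∈ A, ∀ ν ∈ A, IsOfClassOn 𝕜 r (ν ∘ κ.symm) (κ.symm.trans ν).source

/-- `f` is a map of class `C^r`, defined on the open subset `U` of `M`, between the manifolds `M`
and `N` with atlases `A` and `A'`. -/
def IsMfdMapOn {E F : Type*} [AddCommGroup E] [Module 𝕜 E] [Module ℝ E] [TopologicalSpace E]
    [AddCommGroup F] [Module 𝕜 F] [Module ℝ F] [TopologicalSpace F]
    {M N : Type*} [TopologicalSpace M] [TopologicalSpace N] (r : WithTop ℕ∞)
    (A : Set (OpenPartialHomeomorph M E)) (A' : Set (OpenPartialHomeomorph N F))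
    (f : M → N) (U : Set M) : Prop :=
  ContinuousOn f U ∧ ∀ κ ∈ A, ∀ ν ∈ A',
    IsOfClassOn 𝕜 r (ν ∘ f ∘ κ.symm) (κ.target ∩ κ.symm ⁻¹' (U ∩ f ⁻¹' ν.source))

/-- `f` is a `C^r`-diffeomorphism from `M` onto `N`. -/
def IsMfdDiffeo {E F : Type*} [AddCommGroup E] [Module 𝕜 E] [Module ℝ E] [TopologicalSpace E]
    [AddCommGroup F] [Module 𝕜 F] [Module ℝ F] [TopologicalSpace F]
    {M N : Type*} [TopologicalSpace M] [TopologicalSpace N] (r : WithTop ℕ∞)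
    (A : Set (OpenPartialHomeomorph M E)) (A' : Set (OpenPartialHomeomorph N F))
    (f : M → N) : Prop :=
  ∃ g : N → M, Function.LeftInverse g f ∧ Function.RightInverse g f ∧
    IsMfdMapOn 𝕜 r A A' f univ ∧ IsMfdMapOn 𝕜 r A' A g univ

/-- `f` restricts to a `C^r`-diffeomorphism from an open neighbourhood of `x` onto an open subset
of `N`. -/
def IsMfdLocalDiffeoAt {E F : Type*} [AddCommGroup E] [Module 𝕜 E] [Module ℝ E]
    [TopologicalSpace E] [AddCommGroup F] [Module 𝕜 F] [Module ℝ F] [TopologicalSpace F]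
    {M N : Type*} [TopologicalSpace M] [TopologicalSpace N] (r : WithTop ℕ∞)
    (A : Set (OpenPartialHomeomorph M E)) (A' : Set (OpenPartialHomeomorph N F))
    (f : M → N) (x : M) : Prop :=
  ∃ φ : OpenPartialHomeomorph M N, x ∈ φ.source ∧ EqOn f φ φ.source ∧
    IsMfdMapOn 𝕜 r A A' φ φ.source ∧ IsMfdMapOn 𝕜 r A' A φ.symm φ.target

/-- The standard atlas of a locally convex space. -/
def modelAtlas (E : Type*) [TopologicalSpace E] : Set (OpenPartialHomeomorph E E) :=
  {OpenPartialHomeomorph.refl E}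

/-- The product atlas. -/
def prodAtlas {E F M N : Type*} [TopologicalSpace E] [TopologicalSpace F] [TopologicalSpace M]
    [TopologicalSpace N] (A : Set (OpenPartialHomeomorph M E))
    (A' : Set (OpenPartialHomeomorph N F)) : Set (OpenPartialHomeomorph (M × N) (E × F)) :=
  image2 (fun κ ν => κ.prod ν) A A'

/-- The group `G` with the atlas `A` is a Lie group of class `C^r` over `𝕜`. -/
structure IsLCLieGroup {E : Type*} [AddCommGroup E] [Module 𝕜 E] [Module ℝ E]
    [TopologicalSpace E] {G : Type*} [Group G] [TopologicalSpace G] (r : WithTop ℕ∞)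
    (A : Set (OpenPartialHomeomorph G E)) : Prop where
  isLCAtlas : IsLCAtlas 𝕜 r A
  mul : IsMfdMapOn 𝕜 r (prodAtlas A A) A (fun p : G × G => p.1 * p.2) univ
  inv : IsMfdMapOn 𝕜 r A A (fun x : G => x⁻¹) univ

/-- `γ : ℝ → G` is a smooth one-parameter subgroup with `γ'(0) = v`, where the tangent space
`T₁G` is identified with `E` by means of the chart `κ` around `1`. -/
structure IsOneParamSubgroup {E : Type*} [AddCommGroup E] [Module ℝ E] [TopologicalSpace E]
    {G : Type*} [Group G] [TopologicalSpace G] (A : Set (OpenPartialHomeomorph G E))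
    (κ : OpenPartialHomeomorph G E) (γ : ℝ → G) (v : E) : Prop where
  smooth : IsMfdMapOn ℝ ∞ (modelAtlas ℝ) A γ univ
  map_add : ∀ s t : ℝ, γ (s + t) = γ s * γ t
  deriv_zero : HasDirDeriv ℝ (κ ∘ γ) 0 1 v

/-- `e` is the Lie group exponential map `L(G) = T₁G → G`, with `T₁G` identified with `E` by means
of the chart `κ` around `1`: for each `v` there are one-parameter subgroups `γ` with `γ'(0) = v`,
and `e v = γ 1` for each of them. -/
def IsLieExp {E : Type*} [AddCommGroup E] [Module ℝ E] [TopologicalSpace E]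
    {G : Type*} [Group G] [TopologicalSpace G] (A : Set (OpenPartialHomeomorph G E))
    (κ : OpenPartialHomeomorph G E) (e : E → G) : Prop :=
  ∀ v : E, (∃ γ : ℝ → G, IsOneParamSubgroup A κ γ v) ∧
    ∀ γ : ℝ → G, IsOneParamSubgroup A κ γ v → γ 1 = e v

/-- The group `G` with the atlas `A` is a Baker-Campbell-Hausdorff Lie group over `𝕜`: it is a
`𝕜`-analytic Lie group with a smooth exponential map which restricts to a (smooth and
`𝕜`-analytic) diffeomorphism from a neighbourhood of `0` onto a neighbourhood of `1`. -/
structure IsBCHLieGroup {E : Type*} [AddCommGroup E] [Module 𝕜 E] [Module ℝ E]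
    [TopologicalSpace E] {G : Type*} [Group G] [TopologicalSpace G]
    (A : Set (OpenPartialHomeomorph G E)) : Prop where
  smooth : IsLCLieGroup 𝕜 ∞ A
  analytic : IsLCLieGroup 𝕜 ω A
  exp : ∀ κ ∈ A, (1 : G) ∈ κ.source → ∃ e : E → G, IsLieExp A κ e ∧
    IsMfdMapOn 𝕜 ∞ (modelAtlas E) A e univ ∧
    IsMfdLocalDiffeoAt 𝕜 ∞ (modelAtlas E) A e 0 ∧
    IsMfdLocalDiffeoAt 𝕜 ω (modelAtlas E) A e 0

end Manifolds

/-! ### The power series `exp` and `log` are mutually inverse -/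

namespace PowerSeries

variable {K : Type*} [Field K] [CharZero K]

/-! In the convolution algebra Hom(H, B), let F^n be the maps vanishing in degrees below n. The
filtration is multiplicative because Δ respects degrees, and it is separated because every element
of H is a finite sum of homogeneous ones. For x in F^1 the series Σ c_k x^k is a finite sum at each
h, so power series can be evaluated at x, compatibly with products and substitution (`convEval_mul`,
`convEval_subst`). Formal identities then make exp and log inverse bijections between F^1 and 1 +
F^1. By connectedness F^1 consists of the maps killing 1, hence contains all infinitesimal
characters and all φ - 1 with φ a character.

For fixed h, t ↦ exp(t x)(h) is a polynomial in t. For an infinitesimal character the Leibniz rule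
for convolution powers makes these polynomials multiplicative in h, so exp lands in characters
(`convExp_apply_mul`). Conversely, exp(n log φ) = φ^n is a character for every natural n; the
polynomial identity therefore holds for all t, and its linear coefficient says that log φ is
infinitesimal (`convLog_apply_mul`).

At each h, the maps exp, log and (ψ₁, ψ₂) ↦ log(exp ψ₁ ⋆ exp ψ₂) are polynomials in finitely many
evaluations of their arguments. This gives the homeomorphism and, since infinitesimal characters
form a closed subspace of B^H, smoothness of the group law in the chart log. Over ℝ the same formula
for the complexification of B is the holomorphic extension. In this chart inversion is -ψ and exp is
the identity, and a one-parameter subgroup is determined at time 1 by its derivative at 0. -/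

theorem one_add_X_mul_derivative_log :
    (1 + X) * d⁄dX K (log K) = 1 := by
  rw [deriv_log]
  ext n
  rcases n with _ | n
  · simp [add_mul]
  · simp [add_mul, coeff_succ_X_mul, pow_succ, coeff_one]

/-- Here `log K` is the series of log(1 + X). Write q for the composite and m for log', the inverse
of 1 + X. Then q' = q m and m' = -m², so q m has derivative 0 and constant coefficient 1; hence q m
= 1 and q = 1 + X. -/
theorem exp_subst_log : (exp K).subst (log K) = 1 + X := by
  have hL := HasSubst.log (A := K)
  set q := (exp K).subst (log K) with hq
  set m := d⁄dX K (log K) with hm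
  have h1 : (1 + X) * m = 1 := one_add_X_mul_derivative_log
  have hq' : d⁄dX K q = q * m := by
    rw [hq, derivative_subst hL, derivative_exp]
  have hm' : d⁄dX K m = - (m * m) := by
    have h2 := congrArg (d⁄dX K) h1
    rw [Derivation.leibniz] at h2
    simp only [map_add, derivative_X, Derivation.map_one_eq_zero, smul_eq_mul, zero_add,
      mul_one] at h2
    linear_combination m * h2 - (d⁄dX K m) * h1
  have hqm : q * m = 1 := by
    apply derivative.ext
    · rw [Derivation.leibniz, hq', hm', Derivation.map_one_eq_zero]
      simp only [smul_eq_mul]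
      ring
    · have hq0 : constantCoeff q = 1 := by
        have h3 : q = 1 + (exp K - 1).subst (log K) := by
          rw [subst_sub hL, ← coe_substAlgHom hL, map_one, coe_substAlgHom hL]
          ring
        have h4 : constantCoeff ((exp K - 1).subst (log K)) = 0 :=
          constantCoeff_subst_eq_zero (a := log K) constantCoeff_log _ (by simp)
        rw [h3, map_add, h4]
        simp
      have hm0 : constantCoeff m = 1 := by
        have h3 := congrArg constantCoeff h1
        simpa using h3
      simp [hq0, hm0]
  linear_combination (1 + X) * hqm - q * h1

/-- Both sides have constant coefficient 0. Substituting exp - 1 into (1 + X) log' = 1 shows that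
the left side has derivative 1. -/
theorem log_subst_exp_sub_one : (log K).subst (exp K - 1) = X := by
  have hE := HasSubst.exp_sub_one (A := K)
  apply derivative.ext
  · rw [derivative_subst hE, map_sub, derivative_exp, Derivation.map_one_eq_zero, sub_zero,
      derivative_X]
    have h := congrArg (substAlgHom hE) (one_add_X_mul_derivative_log (K := K))
    rw [map_mul, map_add, map_one, substAlgHom_X, coe_substAlgHom hE] at h
    linear_combination h
  · rw [constantCoeff_X]
    exact constantCoeff_subst_eq_zero (a := exp K - 1) (by simp [← constantCoeff_eq]) _
      constantCoeff_log

end PowerSeries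

/-! ### The filtration of the convolution algebra of a graded coalgebra -/

section Filtration

variable {K H B : Type*} [Field K] [Ring H] [HopfAlgebra K H] [CommRing B] [Algebra K B]

/-- The elements of the convolution algebra which vanish on all homogeneous components of degree
less than `n`. -/
def convFiltration (𝒜 : ℕ → Submodule K H) (B : Type*) [CommRing B] [Algebra K B] (n : ℕ) :
    Submodule K (WithConv (H →ₗ[K] B)) where
  carrier := {f | ∀ k < n, ∀ h ∈ 𝒜 k, f h = 0}
  zero_mem' := by intro k _ h _; rfl
  add_mem' := by
    intro f g hf hg k hk h hh
    simp [hf k hk h hh, hg k hk h hh]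
  smul_mem' := by
    intro c f hf k hk h hh
    simp [hf k hk h hh]

variable {𝒜 : ℕ → Submodule K H}

theorem convFiltration_antitone : Antitone (convFiltration 𝒜 B) :=
  fun _ _ hmn _ hf k hk => hf k (hk.trans_le hmn)

theorem mem_convFiltration_zero (f : WithConv (H →ₗ[K] B)) : f ∈ convFiltration 𝒜 B 0 :=
  fun _ hk => absurd hk (Nat.not_lt_zero _)

namespace IsConnectedHopfGrading

variable (h𝒜 : IsConnectedHopfGrading 𝒜)

include h𝒜

/-- In degree k < m + n, every bidegree (p, q) occurring in Δ has p < m or q < n, so f ⊗ g kills it.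
-/
theorem mul_mem_convFiltration {m n : ℕ} {f g : WithConv (H →ₗ[K] B)}
    (hf : f ∈ convFiltration 𝒜 B m) (hg : g ∈ convFiltration 𝒜 B n) :
    f * g ∈ convFiltration 𝒜 B (m + n) := by
  intro k hk h hh
  rw [LinearMap.convMul_apply]
  have key : (⨆ p ∈ Finset.HasAntidiagonal.antidiagonal k,
      LinearMap.range (TensorProduct.map (𝒜 p.1).subtype (𝒜 p.2).subtype)) ≤
      LinearMap.ker (LinearMap.mul' K B ∘ₗ TensorProduct.map f.ofConv g.ofConv) := by
    refine iSup₂_le fun p hp => ?_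
    rw [LinearMap.range_le_ker_iff]
    apply TensorProduct.ext'
    intro a b
    rw [Finset.HasAntidiagonal.mem_antidiagonal] at hp
    have : p.1 < m ∨ p.2 < n := by omega
    rcases this with h1 | h1
    · simp [hf _ h1 a a.2]
    · simp [hg _ h1 b b.2]
  exact key (h𝒜.comul_mem k h hh)

theorem pow_mem_convFiltration {x : WithConv (H →ₗ[K] B)} (hx : x ∈ convFiltration 𝒜 B 1)
    (k : ℕ) : x ^ k ∈ convFiltration 𝒜 B k := by
  induction k with
  | zero => exact mem_convFiltration_zero _
  | succ k ih => exact h𝒜.mul_mem_convFiltration ih hx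

theorem mul_left_mem_convFiltration {n : ℕ} (f : WithConv (H →ₗ[K] B))
    {g : WithConv (H →ₗ[K] B)} (hg : g ∈ convFiltration 𝒜 B n) :
    f * g ∈ convFiltration 𝒜 B n := by
  simpa using h𝒜.mul_mem_convFiltration (mem_convFiltration_zero f) hg

theorem mul_right_mem_convFiltration {n : ℕ} {f : WithConv (H →ₗ[K] B)}
    (hf : f ∈ convFiltration 𝒜 B n) (g : WithConv (H →ₗ[K] B)) :
    f * g ∈ convFiltration 𝒜 B n :=
  h𝒜.mul_mem_convFiltration hf (mem_convFiltration_zero g)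

theorem exists_forall_apply_eq_zero (h : H) :
    ∃ N : ℕ, ∀ n ≥ N, ∀ f ∈ convFiltration 𝒜 B n, f h = 0 := by
  have hh : h ∈ ⨆ n, 𝒜 n := by
    rw [h𝒜.isInternal.submodule_iSup_eq_top]
    trivial
  induction hh using Submodule.iSup_induction' with
  | mem k a ha => exact ⟨k + 1, fun n hn f hf => hf k hn a ha⟩
  | zero => exact ⟨0, fun n _ f _ => map_zero f.ofConv⟩
  | add a b _ _ iha ihb =>
    obtain ⟨Na, hNa⟩ := iha
    obtain ⟨Nb, hNb⟩ := ihb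
    refine ⟨max Na Nb, fun n hn f hf => ?_⟩
    rw [map_add, hNa n (le_trans (le_max_left _ _) hn) f hf,
      hNb n (le_trans (le_max_right _ _) hn) f hf, add_zero]

/-- Separatedness of the filtration: identities between evaluated power series are checked modulo
each F^n, where they become identities of polynomials. -/
theorem eq_of_forall_sub_mem {f g : WithConv (H →ₗ[K] B)}
    (hfg : ∀ n, f - g ∈ convFiltration 𝒜 B n) : f = g := by
  rw [← sub_eq_zero]
  ext h
  obtain ⟨N, hN⟩ := h𝒜.exists_forall_apply_eq_zero (B := B) h
  exact hN N le_rfl _ (hfg N)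

/-- The grading is not assumed to contain 1 in degree 0. Let e₀ be the degree 0 component of 1.
Comparing degree k parts in a = a · 1 for homogeneous a gives a e₀ = a, so e₀ is a right unit and
equals 1. -/
theorem one_mem : (1 : H) ∈ 𝒜 0 := by
  classical
  let : DirectSum.Decomposition 𝒜 := h𝒜.isInternal.chooseDecomposition
  set e := DirectSum.decompose 𝒜 (1 : H) with he
  have hsum : ∑ i ∈ e.support, (e i : H) = 1 := DirectSum.sum_support_decompose 𝒜 1
  have key : ∀ a : H, a * (e 0 : H) = a := by
    intro a
    have ha : a ∈ ⨆ n, 𝒜 n := by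
      rw [h𝒜.isInternal.submodule_iSup_eq_top]
      trivial
    induction ha using Submodule.iSup_induction' with
    | mem k a ha =>
      have h1 : a = ∑ i ∈ e.support, a * (e i : H) := by rw [← Finset.mul_sum, hsum, mul_one]
      have h2 : ∀ i, (DirectSum.decompose 𝒜 (a * (e i : H)) k : H) =
          if i = 0 then a * (e 0 : H) else 0 := by
        intro i
        have hm := h𝒜.mul_mem k i a ha _ (e i).2
        by_cases hi : i = 0
        · subst hi
          rw [if_pos rfl]
          exact DirectSum.decompose_of_mem_same 𝒜 hm
        · rw [if_neg hi]
          exact DirectSum.decompose_of_mem_ne 𝒜 hm (by omega)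
      have h3 : (DirectSum.decompose 𝒜 a k : H) = a := DirectSum.decompose_of_mem_same 𝒜 ha
      rw [h1, DirectSum.decompose_sum, DFinsupp.finsetSum_apply,
        AddSubmonoidClass.coe_finsetSum] at h3
      rw [Finset.sum_congr rfl (fun i _ => h2 i), Finset.sum_ite_eq', ← h1] at h3
      -- If 0 lies outside the support of 1, the comparison of degree k parts says a = 0.
      split_ifs at h3 with h0
      · exact h3
      · rw [← h3, zero_mul]
    | zero => rw [zero_mul]
    | add a b _ _ iha ihb => rw [add_mul, iha, ihb]
  have := key 1
  rw [one_mul] at this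
  rw [← this]
  exact (e 0).2

/-- This is where connectedness enters: 𝒜 0 is a line, and it contains 1, which is nonzero because
ε(1) = 1. -/
theorem mem_convFiltration_one_iff (f : WithConv (H →ₗ[K] B)) :
    f ∈ convFiltration 𝒜 B 1 ↔ f 1 = 0 := by
  refine ⟨fun hf => hf 0 one_pos 1 h𝒜.one_mem, fun hf k hk h hh => ?_⟩
  obtain rfl : k = 0 := by omega
  have h1 : (1 : H) ≠ 0 := by
    intro h10
    have := congrArg (Coalgebra.counit (R := K)) h10
    rw [Bialgebra.counit_one, map_zero] at this
    exact one_ne_zero this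
  obtain ⟨e⟩ := h𝒜.connected
  have hfr : Module.finrank K (𝒜 0) = 1 := by rw [e.finrank_eq, Module.finrank_self]
  obtain ⟨c, hc⟩ := (finrank_eq_one_iff_of_nonzero' (⟨1, h𝒜.one_mem⟩ : 𝒜 0)
    (by simpa [Subtype.ext_iff] using h1)).1 hfr ⟨h, hh⟩
  have hc' : h = c • (1 : H) := by simpa using (congrArg Subtype.val hc).symm
  rw [hc', map_smul, hf, smul_zero]

end IsConnectedHopfGrading

end Filtration

/-! ### Evaluation of power series in the convolution algebra -/

section ConvEval

variable {K H B : Type*} [Field K] [Ring H] [HopfAlgebra K H] [CommRing B] [Algebra K B]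
variable {𝒜 : ℕ → Submodule K H}

/-- The value of the power series `f` at `x`, computed degree by degree. -/
noncomputable def IsConnectedHopfGrading.convEval (h𝒜 : IsConnectedHopfGrading 𝒜)
    (x : WithConv (H →ₗ[K] B)) (f : PowerSeries K) : WithConv (H →ₗ[K] B) :=
  WithConv.toConv <|
    (DirectSum.toModule K ℕ B fun n =>
      -- `trunc (n + 1)` keeps the coefficients up to n. This loses nothing when x is in F^1, since
      -- then x ^ k vanishes on 𝒜 n for k > n.
      (Polynomial.aeval x (PowerSeries.trunc (n + 1) f)).ofConv ∘ₗ (𝒜 n).subtype) ∘ₗ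
    (LinearEquiv.ofBijective (DirectSum.coeLinearMap 𝒜) h𝒜.isInternal).symm.toLinearMap

namespace IsConnectedHopfGrading

variable (h𝒜 : IsConnectedHopfGrading 𝒜) {x : WithConv (H →ₗ[K] B)}

theorem convEval_apply_of_mem (x : WithConv (H →ₗ[K] B)) (f : PowerSeries K) {n : ℕ} {h : H}
    (hh : h ∈ 𝒜 n) :
    h𝒜.convEval x f h = Polynomial.aeval x (PowerSeries.trunc (n + 1) f) h := by
  classical
  have : (LinearEquiv.ofBijective (DirectSum.coeLinearMap 𝒜) h𝒜.isInternal).symm h =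
      DirectSum.lof K ℕ (fun n => 𝒜 n) n ⟨h, hh⟩ := by
    rw [LinearEquiv.symm_apply_eq]
    exact (DirectSum.coeLinearMap_lof 𝒜 n ⟨h, hh⟩).symm
  simp only [convEval, WithConv.ofConv_toConv, LinearMap.comp_apply, LinearEquiv.coe_coe, this]
  rw [DirectSum.toModule_lof]
  rfl

include h𝒜 in
theorem aeval_mem_convFiltration (hx : x ∈ convFiltration 𝒜 B 1) {n : ℕ} {p : Polynomial K}
    (hp : ∀ k < n, p.coeff k = 0) : Polynomial.aeval x p ∈ convFiltration 𝒜 B n := by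
  rw [Polynomial.aeval_eq_sum_range]
  refine Submodule.sum_mem _ fun k _ => ?_
  by_cases hk : k < n
  · rw [hp k hk, zero_smul]
    exact Submodule.zero_mem _
  · exact Submodule.smul_mem _ _
      (convFiltration_antitone (not_lt.1 hk) (h𝒜.pow_mem_convFiltration hx k))

/-- The working description of `convEval`: modulo F^n, any polynomial with the right coefficients
below n may replace the series. -/
theorem convEval_sub_aeval_mem (hx : x ∈ convFiltration 𝒜 B 1) {n : ℕ} {p : Polynomial K}
    {f : PowerSeries K} (hp : ∀ k < n, p.coeff k = PowerSeries.coeff k f) :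
    h𝒜.convEval x f - Polynomial.aeval x p ∈ convFiltration 𝒜 B n := by
  intro k hk h hh
  have h1 := h𝒜.aeval_mem_convFiltration hx (n := k + 1)
    (p := PowerSeries.trunc (k + 1) f - p) (fun j hj => by
      rw [Polynomial.coeff_sub, PowerSeries.coeff_trunc, if_pos hj, hp j (by omega), sub_self])
    k (Nat.lt_succ_self k) h hh
  rw [map_sub] at h1
  rw [WithConv.ofConv_sub, LinearMap.sub_apply, h𝒜.convEval_apply_of_mem x f hh]
  exact h1

theorem convEval_coe (hx : x ∈ convFiltration 𝒜 B 1) (p : Polynomial K) :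
    h𝒜.convEval x (p : PowerSeries K) = Polynomial.aeval x p :=
  h𝒜.eq_of_forall_sub_mem fun _ => h𝒜.convEval_sub_aeval_mem hx fun k _ => by
    rw [Polynomial.coeff_coe]

theorem convEval_mul (hx : x ∈ convFiltration 𝒜 B 1) (f g : PowerSeries K) :
    h𝒜.convEval x (f * g) = h𝒜.convEval x f * h𝒜.convEval x g := by
  refine h𝒜.eq_of_forall_sub_mem fun n => ?_
  have hf := h𝒜.convEval_sub_aeval_mem hx (n := n) (p := PowerSeries.trunc n f) (f := f)
    (fun k hk => by rw [PowerSeries.coeff_trunc, if_pos hk])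
  have hg := h𝒜.convEval_sub_aeval_mem hx (n := n) (p := PowerSeries.trunc n g) (f := g)
    (fun k hk => by rw [PowerSeries.coeff_trunc, if_pos hk])
  have hfg := h𝒜.convEval_sub_aeval_mem hx (n := n)
    (p := PowerSeries.trunc n f * PowerSeries.trunc n g) (f := f * g)
    (fun k hk => by
      rw [PowerSeries.coeff_mul_eq_coeff_trunc_mul_trunc f g hk, ← Polynomial.coe_mul,
        Polynomial.coeff_coe])
  rw [map_mul] at hfg
  set u := h𝒜.convEval x f
  set v := h𝒜.convEval x g
  set a := Polynomial.aeval x (PowerSeries.trunc n f)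
  set b := Polynomial.aeval x (PowerSeries.trunc n g)
  -- Here a and b are the truncated values; each of the three differences lies in F^n, which is a
  -- two-sided ideal.
  have : h𝒜.convEval x (f * g) - u * v =
      (h𝒜.convEval x (f * g) - a * b) - ((u - a) * v + a * (v - b)) := by noncomm_ring
  rw [this]
  exact Submodule.sub_mem _ hfg (Submodule.add_mem _ (h𝒜.mul_right_mem_convFiltration hf _)
    (h𝒜.mul_left_mem_convFiltration _ hg))

theorem convEval_add (x : WithConv (H →ₗ[K] B)) (f g : PowerSeries K) :
    h𝒜.convEval x (f + g) = h𝒜.convEval x f + h𝒜.convEval x g := by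
  refine h𝒜.eq_of_forall_sub_mem fun n k _ h hh => ?_
  rw [WithConv.ofConv_sub, WithConv.ofConv_add, LinearMap.sub_apply, LinearMap.add_apply,
    h𝒜.convEval_apply_of_mem x _ hh, h𝒜.convEval_apply_of_mem x _ hh,
    h𝒜.convEval_apply_of_mem x _ hh, map_add, map_add, WithConv.ofConv_add, LinearMap.add_apply,
    sub_self]

theorem convEval_X (hx : x ∈ convFiltration 𝒜 B 1) : h𝒜.convEval x PowerSeries.X = x := by
  simpa using h𝒜.convEval_coe hx Polynomial.X

theorem convEval_one (hx : x ∈ convFiltration 𝒜 B 1) : h𝒜.convEval x 1 = 1 := by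
  simpa using h𝒜.convEval_coe hx 1

theorem convEval_smul_X (hx : x ∈ convFiltration 𝒜 B 1) (c : K) :
    h𝒜.convEval x (c • PowerSeries.X) = c • x := by
  have h := h𝒜.convEval_coe hx (c • Polynomial.X)
  rwa [Polynomial.coe_smul, Polynomial.coe_X, map_smul, Polynomial.aeval_X] at h

/-- Evaluation of power series as a homomorphism of algebras. -/
noncomputable def convEvalHom (hx : x ∈ convFiltration 𝒜 B 1) :
    PowerSeries K →ₐ[K] WithConv (H →ₗ[K] B) where
  toFun := h𝒜.convEval x
  map_one' := h𝒜.convEval_one hx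
  map_mul' := h𝒜.convEval_mul hx
  map_zero' := by simpa using h𝒜.convEval_coe hx 0
  map_add' := h𝒜.convEval_add x
  commutes' c := by
    have := h𝒜.convEval_coe hx (algebraMap K (Polynomial K) c)
    rwa [AlgHom.commutes, Polynomial.algebraMap_eq, Polynomial.coe_C] at this

theorem convEvalHom_apply (hx : x ∈ convFiltration 𝒜 B 1) (f : PowerSeries K) :
    h𝒜.convEvalHom hx f = h𝒜.convEval x f := rfl

theorem convEval_mem_convFiltration_one (hx : x ∈ convFiltration 𝒜 B 1) {f : PowerSeries K}
    (hf : PowerSeries.constantCoeff f = 0) : h𝒜.convEval x f ∈ convFiltration 𝒜 B 1 := by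
  simpa using h𝒜.convEval_sub_aeval_mem hx (n := 1) (p := 0) (f := f) (by
    intro k hk
    obtain rfl : k = 0 := by omega
    simp [hf])

theorem convEval_subst (hx : x ∈ convFiltration 𝒜 B 1) (f : PowerSeries K) {g : PowerSeries K}
    (hg : PowerSeries.constantCoeff g = 0) :
    h𝒜.convEval x (f.subst g) = h𝒜.convEval (h𝒜.convEval x g) f := by
  have hs : PowerSeries.HasSubst g := PowerSeries.HasSubst.of_constantCoeff_zero' hg
  have hy := h𝒜.convEval_mem_convFiltration_one hx hg
  refine h𝒜.eq_of_forall_sub_mem fun n => ?_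
  set p := PowerSeries.trunc n f with hp
  -- Split f as X^n times a tail plus its truncation. The tail contributes a multiple of g(x)^n,
  -- which is in F^n because g(x) is in F^1; the truncation is a polynomial, on which substitution
  -- is clear.
  have h1 : f.subst g = g ^ n * (PowerSeries.mk fun i ↦ PowerSeries.coeff (i + n) f).subst g +
      Polynomial.aeval g p := by
    conv_lhs => rw [PowerSeries.eq_X_pow_mul_shift_add_trunc n f]
    rw [PowerSeries.subst_add hs, PowerSeries.subst_mul hs, PowerSeries.subst_pow hs,
      PowerSeries.subst_X hs, PowerSeries.subst_coe hs]
  have h2 := h𝒜.convEval_sub_aeval_mem hy (n := n) (p := p) (f := f)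
    (fun k hk => by rw [hp, PowerSeries.coeff_trunc, if_pos hk])
  have h3 : h𝒜.convEval x (Polynomial.aeval g p) = Polynomial.aeval (h𝒜.convEval x g) p := by
    rw [← convEvalHom_apply h𝒜 hx, ← Polynomial.aeval_algHom_apply, convEvalHom_apply]
  have h4 : h𝒜.convEval x (g ^ n) = h𝒜.convEval x g ^ n := map_pow (h𝒜.convEvalHom hx) g n
  rw [h1, convEval_add, convEval_mul h𝒜 hx, h3, h4, add_sub_assoc]
  refine Submodule.add_mem _ (h𝒜.mul_right_mem_convFiltration (h𝒜.pow_mem_convFiltration hy n) _)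
    ?_
  rw [← neg_sub]
  exact Submodule.neg_mem _ h2

/-- The bound N depends on h alone, not on x or f. This uniformity makes each coordinate of exp and
log a genuine polynomial map in x. -/
theorem exists_convEval_apply (h𝒜 : IsConnectedHopfGrading 𝒜) (B : Type*) [CommRing B]
    [Algebra K B] (h : H) :
    ∃ N : ℕ, ∀ x ∈ convFiltration 𝒜 B 1,
      (∀ k ≥ N, (x ^ k) h = 0) ∧ ∀ f : PowerSeries K,
        h𝒜.convEval x f h = ∑ k ∈ Finset.range N, PowerSeries.coeff k f • (x ^ k) h := by
  obtain ⟨N, hN⟩ := h𝒜.exists_forall_apply_eq_zero (B := B) h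
  refine ⟨N, fun x hx => ⟨fun k hk => hN k hk _ (h𝒜.pow_mem_convFiltration hx k), fun f => ?_⟩⟩
  have h1 := hN N le_rfl _ (h𝒜.convEval_sub_aeval_mem hx
    (p := ∑ k ∈ Finset.range N, Polynomial.monomial k (PowerSeries.coeff k f)) (f := f)
    (fun k hk => by simp [Polynomial.coeff_monomial, hk]))
  rw [WithConv.ofConv_sub, LinearMap.sub_apply, sub_eq_zero] at h1
  rw [h1]
  simp [Polynomial.aeval_monomial, ← Algebra.smul_def]

variable [CharZero K]

/-- The exponential of an element of the convolution algebra. -/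
noncomputable def convExp (x : WithConv (H →ₗ[K] B)) : WithConv (H →ₗ[K] B) :=
  h𝒜.convEval x (PowerSeries.exp K)

/-- The logarithm of an element of the convolution algebra. -/
noncomputable def convLog (y : WithConv (H →ₗ[K] B)) : WithConv (H →ₗ[K] B) :=
  h𝒜.convEval (y - 1) (PowerSeries.log K)

theorem convExp_sub_one_eq (hx : x ∈ convFiltration 𝒜 B 1) :
    h𝒜.convExp x - 1 = h𝒜.convEval x (PowerSeries.exp K - 1) := by
  rw [← convEvalHom_apply h𝒜 hx, map_sub, map_one]
  rfl

theorem convExp_sub_one_mem (hx : x ∈ convFiltration 𝒜 B 1) :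
    h𝒜.convExp x - 1 ∈ convFiltration 𝒜 B 1 := by
  rw [convExp_sub_one_eq h𝒜 hx]
  exact h𝒜.convEval_mem_convFiltration_one hx (by simp)

theorem convLog_mem {y : WithConv (H →ₗ[K] B)} (hy : y - 1 ∈ convFiltration 𝒜 B 1) :
    h𝒜.convLog y ∈ convFiltration 𝒜 B 1 :=
  h𝒜.convEval_mem_convFiltration_one hy PowerSeries.constantCoeff_log

theorem convLog_convExp (hx : x ∈ convFiltration 𝒜 B 1) : h𝒜.convLog (h𝒜.convExp x) = x := by
  rw [convLog, convExp_sub_one_eq h𝒜 hx, ← convEval_subst h𝒜 hx _ (by simp),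
    PowerSeries.log_subst_exp_sub_one, convEval_X h𝒜 hx]

theorem convExp_convLog {y : WithConv (H →ₗ[K] B)} (hy : y - 1 ∈ convFiltration 𝒜 B 1) :
    h𝒜.convExp (h𝒜.convLog y) = y := by
  rw [convLog, convExp, ← convEval_subst h𝒜 hy _ PowerSeries.constantCoeff_log,
    PowerSeries.exp_subst_log, convEval_add, convEval_one h𝒜 hy, convEval_X h𝒜 hy,
    add_sub_cancel]

/-- All exp(c x) become series in the same x, so their multiplication laws follow from those of the
formal series exp(cX). -/
theorem convExp_smul (hx : x ∈ convFiltration 𝒜 B 1) (c : K) :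
    h𝒜.convExp (c • x) = h𝒜.convEval x (PowerSeries.rescale c (PowerSeries.exp K)) := by
  rw [PowerSeries.rescale_eq_subst, convEval_subst h𝒜 hx _ (by simp), convEval_smul_X h𝒜 hx,
    convExp]

theorem convExp_add_smul (hx : x ∈ convFiltration 𝒜 B 1) (a b : K) :
    h𝒜.convExp ((a + b) • x) = h𝒜.convExp (a • x) * h𝒜.convExp (b • x) := by
  rw [convExp_smul h𝒜 hx, convExp_smul h𝒜 hx, convExp_smul h𝒜 hx,
    ← PowerSeries.exp_mul_exp_eq_exp_add, convEval_mul h𝒜 hx]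

theorem convExp_zero : h𝒜.convExp (0 : WithConv (H →ₗ[K] B)) = 1 := by
  have h0 : (0 : WithConv (H →ₗ[K] B)) ∈ convFiltration 𝒜 B 1 := Submodule.zero_mem _
  have := h𝒜.convExp_smul h0 0
  rw [smul_zero] at this
  rw [this]
  simp [← convEvalHom_apply h𝒜 h0]

theorem convExp_nat_smul (hx : x ∈ convFiltration 𝒜 B 1) (n : ℕ) :
    h𝒜.convExp ((n : K) • x) = h𝒜.convExp x ^ n := by
  rw [convExp_smul h𝒜 hx, ← PowerSeries.exp_pow_eq_rescale_exp, ← convEvalHom_apply h𝒜 hx, map_pow]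
  rfl

end IsConnectedHopfGrading

end ConvEval

/-! ### The exponential bijection between infinitesimal characters and characters -/

/-- B may have zero divisors, so roots cannot be counted in B. Applying a K-linear functional to the
coefficients gives a polynomial over the field K with infinitely many roots, and such functionals
separate the points of B. -/
theorem Polynomial.eq_zero_of_forall_eval_natCast (K : Type*) {B : Type*} [Field K] [CharZero K]
    [CommRing B] [Algebra K B] {p : Polynomial B} (hp : ∀ n : ℕ, p.eval (n : B) = 0) : p = 0 := by
  ext k
  rw [Polynomial.coeff_zero]
  rw [← Module.forall_dual_apply_eq_zero_iff K]
  intro l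
  set q : Polynomial K :=
    ∑ i ∈ Finset.range (p.natDegree + 1), Polynomial.monomial i (l (p.coeff i)) with hq
  have hq0 : q = 0 := by
    refine Polynomial.eq_zero_of_infinite_isRoot q
      (Set.Infinite.mono ?_ (Set.infinite_range_of_injective (Nat.cast_injective (R := K))))
    rintro _ ⟨n, rfl⟩
    have h1 := congrArg l (hp n)
    rw [Polynomial.eval_eq_sum_range, map_zero, map_sum] at h1
    change q.eval (n : K) = 0
    rw [hq, Polynomial.eval_finsetSum, ← h1]
    refine Finset.sum_congr rfl fun i _ => ?_
    rw [Polynomial.eval_monomial, mul_comm (p.coeff i), ← map_natCast (algebraMap K B), ← map_pow,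
      ← Algebra.smul_def, map_smul, smul_eq_mul, mul_comm]
  have h2 := congrArg (fun r => Polynomial.coeff r k) hq0
  simp only [hq, Polynomial.finsetSum_coeff, Polynomial.coeff_monomial, Polynomial.coeff_zero,
    Finset.sum_ite_eq', Finset.mem_range] at h2
  split_ifs at h2 with hk
  · exact h2
  · rw [Polynomial.coeff_eq_zero_of_natDegree_lt (by omega), map_zero]

/-! ### Convolution powers under composition and tensor products. -/

namespace LinearMap

variable {K C D A A' : Type*} [CommSemiring K] [AddCommMonoid C] [Module K C] [Coalgebra K C]
  [AddCommMonoid D] [Module K D] [Coalgebra K D] [Semiring A] [Algebra K A] [Semiring A']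
  [Algebra K A']

theorem convPow_comp_coalgHom (f : WithConv (C →ₗ[K] A)) (h : D →ₗc[K] C) (n : ℕ) :
    (f ^ n).ofConv ∘ₗ h.toLinearMap =
      (WithConv.toConv (f.ofConv ∘ₗ h.toLinearMap) ^ n).ofConv := by
  induction n with
  | zero =>
    ext d
    simp
  | succ n ih => rw [pow_succ, pow_succ, convMul_comp_coalgHom_distrib, ih, WithConv.toConv_ofConv]

theorem algHom_comp_convPow (h : A →ₐ[K] A') (f : WithConv (C →ₗ[K] A)) (n : ℕ) :
    h.toLinearMap ∘ₗ (f ^ n).ofConv =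
      (WithConv.toConv (h.toLinearMap ∘ₗ f.ofConv) ^ n).ofConv := by
  induction n with
  | zero =>
    ext d
    simp
  | succ n ih => rw [pow_succ, pow_succ, algHom_comp_convMul_distrib, ih, WithConv.toConv_ofConv]

theorem convPow_map_one (f : WithConv (C →ₗ[K] A)) (n : ℕ) :
    WithConv.toConv (TensorProduct.map f.ofConv (1 : WithConv (D →ₗ[K] A')).ofConv) ^ n =
      WithConv.toConv (TensorProduct.map (f ^ n).ofConv (1 : WithConv (D →ₗ[K] A')).ofConv) := by
  induction n with
  | zero =>
    ext c d
    simp [Algebra.algebraMap_eq_smul_one, Algebra.TensorProduct.one_def, TensorProduct.smul_tmul',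
      TensorProduct.tmul_smul, smul_smul]
  | succ n ih => rw [pow_succ, pow_succ, ih, TensorProduct.map_convMul_map, mul_one]

theorem convPow_one_map (f : WithConv (C →ₗ[K] A)) (n : ℕ) :
    WithConv.toConv (TensorProduct.map (1 : WithConv (D →ₗ[K] A')).ofConv f.ofConv) ^ n =
      WithConv.toConv (TensorProduct.map (1 : WithConv (D →ₗ[K] A')).ofConv (f ^ n).ofConv) := by
  induction n with
  | zero =>
    ext c d
    simp [Algebra.algebraMap_eq_smul_one, Algebra.TensorProduct.one_def, TensorProduct.smul_tmul',
      TensorProduct.tmul_smul, smul_smul]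
  | succ n ih => rw [pow_succ, pow_succ, ih, TensorProduct.map_convMul_map, mul_one]

end LinearMap

section CharExp

variable {K H B : Type*} [Field K] [Ring H] [HopfAlgebra K H] [CommRing B] [Algebra K B]

/-- The higher Leibniz rule. With u = ψ ⊗ 1 and v = 1 ⊗ ψ in the convolution algebra of H ⊗ H, being
infinitesimal means ψ ∘ m_H = m_B ∘ (u + v). Since m_H is a coalgebra map and m_B an algebra map (B
is commutative), both pass through convolution powers, and the binomial theorem applies to the
commuting u and v. -/
theorem InfChar.convPow_apply_mul (ψ : InfChar K H B) (n : ℕ) (a b : H) :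
    (WithConv.toConv (ψ : H →ₗ[K] B) ^ n) (a * b) =
      ∑ p ∈ Finset.HasAntidiagonal.antidiagonal n, n.choose p.1 •
        ((WithConv.toConv (ψ : H →ₗ[K] B) ^ p.1) a *
          (WithConv.toConv (ψ : H →ₗ[K] B) ^ p.2) b) := by
  set x := WithConv.toConv (ψ : H →ₗ[K] B) with hx
  set u := WithConv.toConv (TensorProduct.map x.ofConv (1 : WithConv (H →ₗ[K] B)).ofConv) with hu
  set v := WithConv.toConv (TensorProduct.map (1 : WithConv (H →ₗ[K] B)).ofConv x.ofConv) with hv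
  have huv : Commute u v := by
    change u * v = v * u
    rw [hu, hv, TensorProduct.map_convMul_map, TensorProduct.map_convMul_map]
    simp
  have h1 : x.ofConv ∘ₗ (Bialgebra.mulCoalgHom K H).toLinearMap =
      (Algebra.TensorProduct.lmul' K (S := B)).toLinearMap ∘ₗ (u + v).ofConv := by
    apply TensorProduct.ext'
    intro a b
    have := ψ.2 a b
    have hm : (Bialgebra.mulCoalgHom K H).toLinearMap (a ⊗ₜ b) = a * b := rfl
    simp only [hu, hv, hx, hm, LinearMap.comp_apply, WithConv.ofConv_add, LinearMap.add_apply,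
      TensorProduct.map_tmul,
      map_add, AlgHom.toLinearMap_apply, Algebra.TensorProduct.lmul'_apply_tmul,
      LinearMap.convOne_apply]
    rw [this, Algebra.smul_def, Algebra.smul_def, mul_comm]
  have h2 := LinearMap.congr_fun (LinearMap.convPow_comp_coalgHom x (Bialgebra.mulCoalgHom K H) n)
    (a ⊗ₜ b)
  rw [h1, ← LinearMap.algHom_comp_convPow, huv.add_pow'] at h2
  simp only [hu, hv, LinearMap.convPow_map_one, LinearMap.convPow_one_map,
    TensorProduct.map_convMul_map, mul_one, one_mul, ← Nat.cast_smul_eq_nsmul K] at h2 ⊢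
  simpa using h2

variable {𝒜 : ℕ → Submodule K H} (h𝒜 : IsConnectedHopfGrading 𝒜)

namespace IsConnectedHopfGrading

include h𝒜 in
theorem infChar_mem_convFiltration [CharZero K] (ψ : InfChar K H B) :
    WithConv.toConv (ψ : H →ₗ[K] B) ∈ convFiltration 𝒜 B 1 := by
  rw [h𝒜.mem_convFiltration_one_iff]
  have := ψ.2 1 1
  simpa using this

include h𝒜 in
theorem char_sub_one_mem_convFiltration (φ : H →ₐ[K] B) :
    WithConv.toConv φ.toLinearMap - 1 ∈ convFiltration 𝒜 B 1 := by
  rw [h𝒜.mem_convFiltration_one_iff]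
  simp

variable [CharZero K]

/-- The parameter t turns statements about exp into polynomial identities, whose coefficients can be
compared. -/
theorem exists_polynomial_convExp {x : WithConv (H →ₗ[K] B)} (hx : x ∈ convFiltration 𝒜 B 1)
    (h : H) : ∃ P : Polynomial B,
      (∀ k, P.coeff k = (k.factorial : K)⁻¹ • (x ^ k) h) ∧
      ∀ t : K, h𝒜.convExp (t • x) h = P.eval (algebraMap K B t) := by
  obtain ⟨N, hN⟩ := h𝒜.exists_convEval_apply B h
  refine ⟨∑ k ∈ Finset.range N, Polynomial.monomial k ((k.factorial : K)⁻¹ • (x ^ k) h),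
    fun k => ?_, fun t => ?_⟩
  · simp only [Polynomial.finsetSum_coeff, Polynomial.coeff_monomial, Finset.sum_ite_eq',
      Finset.mem_range]
    split_ifs with hk
    · rfl
    · rw [(hN x hx).1 k (not_lt.1 hk), smul_zero]
  · rw [h𝒜.convExp_smul hx, (hN x hx).2, Polynomial.eval_finsetSum]
    refine Finset.sum_congr rfl fun k _ => ?_
    rw [PowerSeries.coeff_rescale, PowerSeries.coeff_exp, Polynomial.eval_monomial, ← map_pow,
      mul_comm _ (algebraMap K B (t ^ k)), ← Algebra.smul_def, smul_smul]
    simp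

theorem convExp_apply_mul (ψ : InfChar K H B) (a b : H) :
    h𝒜.convExp (WithConv.toConv (ψ : H →ₗ[K] B)) (a * b) =
      h𝒜.convExp (WithConv.toConv (ψ : H →ₗ[K] B)) a *
        h𝒜.convExp (WithConv.toConv (ψ : H →ₗ[K] B)) b := by
  have hx := h𝒜.infChar_mem_convFiltration ψ
  obtain ⟨P, hP, hP'⟩ := h𝒜.exists_polynomial_convExp hx a
  obtain ⟨Q, hQ, hQ'⟩ := h𝒜.exists_polynomial_convExp hx b
  obtain ⟨R, hR, hR'⟩ := h𝒜.exists_polynomial_convExp hx (a * b)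
  -- Coefficientwise this is the Leibniz rule divided by n!; evaluation at t = 1 then gives the
  -- claim.
  have h : R = P * Q := by
    ext n
    rw [hR, Polynomial.coeff_mul, InfChar.convPow_apply_mul, Finset.smul_sum]
    refine Finset.sum_congr rfl fun p hp => ?_
    rw [hP, hQ, smul_mul_smul_comm, ← Nat.cast_smul_eq_nsmul K, smul_smul]
    congr 1
    rw [Finset.HasAntidiagonal.mem_antidiagonal] at hp
    have h1 : (n.factorial : K) ≠ 0 := Nat.cast_ne_zero.2 n.factorial_ne_zero
    have h2 : (p.1.factorial : K) ≠ 0 := Nat.cast_ne_zero.2 p.1.factorial_ne_zero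
    have h3 : (p.2.factorial : K) ≠ 0 := Nat.cast_ne_zero.2 p.2.factorial_ne_zero
    have h4 := Nat.choose_mul_factorial_mul_factorial (n := n) (k := p.1) (by omega)
    rw [show n - p.1 = p.2 by omega] at h4
    have h5 : (n.choose p.1 : K) * p.1.factorial * p.2.factorial = n.factorial := by
      exact_mod_cast h4
    field_simp
    linear_combination h5
  have e1 := hP' 1
  have e2 := hQ' 1
  have e3 := hR' 1
  rw [one_smul] at e1 e2 e3
  rw [e1, e2, e3, h, Polynomial.eval_mul]

theorem convLog_apply_mul (φ : CharGroup K H B) (a b : H) :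
    h𝒜.convLog (WithConv.toConv φ.ofConv.toLinearMap) (a * b) =
      Coalgebra.counit (R := K) b • h𝒜.convLog (WithConv.toConv φ.ofConv.toLinearMap) a +
        Coalgebra.counit (R := K) a • h𝒜.convLog (WithConv.toConv φ.ofConv.toLinearMap) b := by
  have hy := h𝒜.char_sub_one_mem_convFiltration φ.ofConv
  have hx := h𝒜.convLog_mem hy
  obtain ⟨P, hP, hP'⟩ := h𝒜.exists_polynomial_convExp hx a
  obtain ⟨Q, hQ, hQ'⟩ := h𝒜.exists_polynomial_convExp hx b
  obtain ⟨R, hR, hR'⟩ := h𝒜.exists_polynomial_convExp hx (a * b)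
  have key : ∀ (n : ℕ) (h : H), h𝒜.convExp
      ((n : K) • h𝒜.convLog (WithConv.toConv φ.ofConv.toLinearMap)) h = (φ ^ n) h := by
    intro n h
    rw [h𝒜.convExp_nat_smul hx, h𝒜.convExp_convLog hy, ← AlgHom.toLinearMap_convPow]
    rfl
  -- At t = n the three polynomials take the values of the character φ ^ n, which is multiplicative.
  have h : R - P * Q = 0 := by
    refine Polynomial.eq_zero_of_forall_eval_natCast K fun n => ?_
    rw [Polynomial.eval_sub, Polynomial.eval_mul, ← map_natCast (algebraMap K B), ← hP', ← hQ',
      ← hR', key, key, key, map_mul, sub_self]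
  rw [sub_eq_zero] at h
  -- The constant coefficients are values of the convolution unit, that is, of the counit; the
  -- linear ones are values of log φ.
  have h1 := congrArg (fun p => Polynomial.coeff p 1) h
  simp only [Polynomial.mul_coeff_one, hP, hQ, hR, pow_one, Nat.factorial, Nat.cast_one, inv_one,
    one_smul, pow_zero, LinearMap.convOne_apply, zero_add, mul_one, Nat.succ_eq_add_one] at h1
  rw [h1, Algebra.smul_def, Algebra.smul_def]
  ring

/-- The exponential bijection from infinitesimal characters to characters. -/
noncomputable def charExp : InfChar K H B ≃ CharGroup K H B where
  toFun ψ := WithConv.toConv <| AlgHom.ofLinearMap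
    (h𝒜.convExp (WithConv.toConv (ψ : H →ₗ[K] B))).ofConv
    (by
      have h := (h𝒜.mem_convFiltration_one_iff _).1
        (h𝒜.convExp_sub_one_mem (h𝒜.infChar_mem_convFiltration ψ))
      rw [WithConv.ofConv_sub, LinearMap.sub_apply, sub_eq_zero] at h
      rw [h]
      simp)
    (h𝒜.convExp_apply_mul ψ)
  invFun φ := ⟨(h𝒜.convLog (WithConv.toConv φ.ofConv.toLinearMap)).ofConv,
    h𝒜.convLog_apply_mul φ⟩
  left_inv ψ := by
    apply Subtype.ext
    exact congrArg WithConv.ofConv (h𝒜.convLog_convExp (h𝒜.infChar_mem_convFiltration ψ))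
  right_inv φ := by
    apply WithConv.ofConv_injective
    apply AlgHom.toLinearMap_injective
    exact congrArg WithConv.ofConv
      (h𝒜.convExp_convLog (h𝒜.char_sub_one_mem_convFiltration φ.ofConv))

theorem charExp_add_smul (ψ : InfChar K H B) (a b : K) :
    h𝒜.charExp ((a + b) • ψ) = h𝒜.charExp (a • ψ) * h𝒜.charExp (b • ψ) := by
  apply WithConv.ofConv_injective
  apply AlgHom.toLinearMap_injective
  exact congrArg WithConv.ofConv (h𝒜.convExp_add_smul (h𝒜.infChar_mem_convFiltration ψ) a b)

theorem charExp_zero : h𝒜.charExp (0 : InfChar K H B) = 1 := by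
  apply WithConv.ofConv_injective
  apply AlgHom.toLinearMap_injective
  exact congrArg WithConv.ofConv h𝒜.convExp_zero

theorem charExp_neg (ψ : InfChar K H B) : h𝒜.charExp (-ψ) = (h𝒜.charExp ψ)⁻¹ := by
  rw [eq_comm, inv_eq_iff_mul_eq_one]
  have h := h𝒜.charExp_add_smul ψ 1 (-1)
  have e : (-1 : K) • ψ = -ψ := by
    apply Subtype.ext
    apply LinearMap.ext
    intro h
    exact neg_one_smul K ((ψ : H →ₗ[K] B) h)
  rw [e, add_neg_cancel, zero_smul, charExp_zero, one_smul] at h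
  exact h.symm

theorem charExp_nat_smul (ψ : InfChar K H B) (n : ℕ) :
    h𝒜.charExp ((n : K) • ψ) = h𝒜.charExp ψ ^ n := by
  induction n with
  | zero => rw [Nat.cast_zero, zero_smul, charExp_zero, pow_zero]
  | succ n ih => rw [Nat.cast_succ, charExp_add_smul, ih, one_smul, pow_succ]

theorem hasSum_charExp [TopologicalSpace B] (ψ : InfChar K H B) (h : H) :
    HasSum (fun k : ℕ => (k.factorial : K)⁻¹ • (WithConv.toConv (ψ : H →ₗ[K] B) ^ k) h)
      (h𝒜.charExp ψ h) := by
  obtain ⟨N, hN⟩ := h𝒜.exists_convEval_apply B h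
  obtain ⟨h1, h2⟩ := hN _ (h𝒜.infChar_mem_convFiltration ψ)
  have h3 : h𝒜.charExp ψ h = ∑ k ∈ Finset.range N,
      (k.factorial : K)⁻¹ • (WithConv.toConv (ψ : H →ₗ[K] B) ^ k) h := by
    refine (h2 (PowerSeries.exp K)).trans (Finset.sum_congr rfl fun k _ => ?_)
    simp [PowerSeries.coeff_exp]
  rw [h3]
  -- Only finitely many terms are nonzero, so no completeness of B is needed.
  refine hasSum_sum_of_ne_finset_zero fun k hk => ?_
  rw [h1 k (by simpa using hk), smul_zero]

end IsConnectedHopfGrading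

end CharExp

/-! ### Differentiability of polynomial maps -/

/-! ### Rules for directional derivatives. -/

section DirDeriv

variable {L : Type*} [RCLike L] {X Y : Type*} [AddCommGroup X] [Module L X]
  [AddCommGroup Y] [Module L Y]

theorem HasDirDeriv.const {F : Type*} [AddCommGroup F] [Module L F] [TopologicalSpace F] (c : F)
    (x h : X) : HasDirDeriv L (fun _ : X => c) x h 0 := by
  simp only [HasDirDeriv, sub_self, smul_zero]
  exact tendsto_const_nhds

theorem HasDirDeriv.linearMap {F : Type*} [AddCommGroup F] [Module L F] [TopologicalSpace F]
    (T : X →ₗ[L] F) (x h : X) : HasDirDeriv L T x h (T h) := by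
  refine tendsto_const_nhds.congr' ?_
  filter_upwards [self_mem_nhdsWithin] with t ht
  rw [map_add, map_smul, add_sub_cancel_left, inv_smul_smul₀ ht]

theorem HasDirDeriv.add {F : Type*} [AddCommGroup F] [Module L F] [TopologicalSpace F]
    [ContinuousAdd F] {f g : X → F} {x h : X} {u v : F} (hf : HasDirDeriv L f x h u)
    (hg : HasDirDeriv L g x h v) : HasDirDeriv L (f + g) x h (u + v) := by
  refine (Tendsto.add hf hg).congr fun t => ?_
  rw [← smul_add, Pi.add_apply, Pi.add_apply]
  congr 1
  abel

/-- Continuity along the line of differentiation, which the product rule needs. -/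
theorem HasDirDeriv.tendsto {F : Type*} [AddCommGroup F] [Module L F] [TopologicalSpace F]
    [ContinuousAdd F] [ContinuousSMul L F] {f : X → F} {x h : X} {v : F}
    (hf : HasDirDeriv L f x h v) : Tendsto (fun t : L => f (x + t • h)) (𝓝[≠] 0) (𝓝 (f x)) := by
  have h0 : Tendsto (fun t : L => t) (𝓝[≠] 0) (𝓝 0) := nhdsWithin_le_nhds
  have h1 := (h0.smul hf).add_const (f x)
  rw [zero_smul, zero_add] at h1
  refine h1.congr' ?_
  filter_upwards [self_mem_nhdsWithin] with t ht
  rw [smul_inv_smul₀ ht, sub_add_cancel]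

theorem HasDirDeriv.mul {B : Type*} [CommRing B] [Algebra L B] [TopologicalSpace B]
    [IsTopologicalRing B] [ContinuousSMul L B] {f g : X → B} {x h : X} {u v : B}
    (hf : HasDirDeriv L f x h u) (hg : HasDirDeriv L g x h v) :
    HasDirDeriv L (f * g) x h (u * g x + f x * v) := by
  refine ((Tendsto.mul hf hg.tendsto).add (Tendsto.mul (tendsto_const_nhds (x := f x)) hg)).congr
    fun t => ?_
  rw [smul_mul_assoc, mul_smul_comm, ← smul_add, Pi.mul_apply, Pi.mul_apply]
  congr 1
  ring

theorem HasDirDeriv.prodMk_left {F : Type*} [AddCommGroup F] [Module L F] [TopologicalSpace F]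
    {f : X × Y → F} {x h : X} {y : Y} {v : F} (hf : HasDirDeriv L f (x, y) (h, 0) v) :
    HasDirDeriv L (fun z => f (z, y)) x h v := by
  simpa [HasDirDeriv] using hf

end DirDeriv

/-! ### Polynomial maps into closed subspaces of B^I are smooth. -/

section PolyMaps

variable (L : Type*) [RCLike L] (K : Type*) [CommSemiring K]
  (X : Type*) [AddCommGroup X] [Module L X] [TopologicalSpace X]
  (B : Type*) [CommRing B] [Algebra L B] [Algebra K B] [TopologicalSpace B]

/-- The algebra of maps generated by continuous `L`-linear maps and constants from `K`. -/
def polyMaps : Subalgebra K (X → B) :=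
  Algebra.adjoin K (range fun T : X →L[L] B => ⇑T)

variable {L K X B}

theorem continuousLinearMap_mem_polyMaps (T : X →L[L] B) : ⇑T ∈ polyMaps L K X B :=
  Algebra.subset_adjoin ⟨T, rfl⟩

theorem mem_polyMaps_of_linear {g : X → B} (hadd : ∀ x y, g (x + y) = g x + g y)
    (hsmul : ∀ (c : L) x, g (c • x) = c • g x) (hg : Continuous g) : g ∈ polyMaps L K X B :=
  continuousLinearMap_mem_polyMaps ⟨⟨⟨g, hadd⟩, hsmul⟩, hg⟩

theorem comp_mem_polyMaps {Y : Type*} [AddCommGroup Y] [Module L Y] [TopologicalSpace Y]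
    {g : X → B} (hg : g ∈ polyMaps L K X B) (T : Y →L[L] X) : g ∘ T ∈ polyMaps L K Y B := by
  induction hg using Algebra.adjoin_induction with
  | mem g hg =>
    obtain ⟨S, rfl⟩ := hg
    exact continuousLinearMap_mem_polyMaps (S.comp T)
  | algebraMap c => exact Subalgebra.algebraMap_mem (polyMaps L K Y B) c
  | add f g _ _ hf hg => exact Subalgebra.add_mem _ hf hg
  | mul f g _ _ hf hg => exact Subalgebra.mul_mem _ hf hg

theorem continuous_of_mem_polyMaps [IsTopologicalRing B] {g : X → B}
    (hg : g ∈ polyMaps L K X B) : Continuous g := by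
  induction hg using Algebra.adjoin_induction with
  | mem g hg =>
    obtain ⟨S, rfl⟩ := hg
    exact S.continuous
  | algebraMap c => exact continuous_const
  | add f g _ _ hf hg => exact hf.add hg
  | mul f g _ _ hf hg => exact hf.mul hg

/-- The derivative is again polynomial, jointly in point and direction, so differentiation can be
iterated. L is the field of differentiation and K the field of the Hopf algebra; they differ when a
real situation is complexified. -/
theorem exists_dirDeriv_of_mem_polyMaps [IsTopologicalRing B] [ContinuousSMul L B] {g : X → B}
    (hg : g ∈ polyMaps L K X B) : ∃ g' ∈ polyMaps L K (X × X) B,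
      ∀ x h : X, HasDirDeriv L g x h (g' (x, h)) := by
  induction hg using Algebra.adjoin_induction with
  | mem g hg =>
    obtain ⟨S, rfl⟩ := hg
    exact ⟨_, continuousLinearMap_mem_polyMaps (S.comp (ContinuousLinearMap.snd L X X)),
      fun x h => HasDirDeriv.linearMap S.toLinearMap x h⟩
  | algebraMap c => exact ⟨0, Subalgebra.zero_mem _, fun x h => HasDirDeriv.const _ x h⟩
  | add f g _ _ hf hg =>
    obtain ⟨f', hf', hf⟩ := hf
    obtain ⟨g', hg', hg⟩ := hg
    exact ⟨f' + g', Subalgebra.add_mem _ hf' hg', fun x h => (hf x h).add (hg x h)⟩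
  | mul f g hfm hgm hf hg =>
    obtain ⟨f', hf', hf⟩ := hf
    obtain ⟨g', hg', hg⟩ := hg
    refine ⟨f' * (g ∘ ContinuousLinearMap.fst L X X) + (f ∘ ContinuousLinearMap.fst L X X) * g',
      Subalgebra.add_mem _ (Subalgebra.mul_mem _ hf' (comp_mem_polyMaps hgm _))
        (Subalgebra.mul_mem _ (comp_mem_polyMaps hfm _) hg'),
      fun x h => (hf x h).mul (hg x h)⟩

variable {F I : Type*} [AddCommGroup F] [Module L F] [TopologicalSpace F]

/-- The derivative is computed coordinatewise in B^I. The difference quotients lie in the image of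
F, and this image is closed, so the limit comes from F. -/
theorem exists_dirDeriv_of_forall_mem_polyMaps [IsTopologicalRing B] [ContinuousSMul L B]
    (ι : F →ₗ[L] (I → B)) (hι : IsClosedEmbedding ι) {f : X → F}
    (hf : ∀ i, (fun x => ι (f x) i) ∈ polyMaps L K X B) :
    ∃ f' : X × X → F, (∀ i, (fun p => ι (f' p) i) ∈ polyMaps L K (X × X) B) ∧
      ∀ x h : X, HasDirDeriv L f x h (f' (x, h)) := by
  choose g' hg' hg using fun i => exists_dirDeriv_of_mem_polyMaps (hf i)
  have hlim : ∀ x h : X, Tendsto (fun t : L => ι (t⁻¹ • (f (x + t • h) - f x))) (𝓝[≠] 0)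
      (𝓝 fun i => g' i (x, h)) := by
    intro x h
    rw [tendsto_pi_nhds]
    intro i
    refine (hg i x h).congr fun t => ?_
    simp
  have hmem : ∀ p : X × X, ∃ v : F, ι v = fun i => g' i p := fun p =>
    hι.isClosed_range.mem_of_tendsto (hlim p.1 p.2) (Eventually.of_forall fun t => ⟨_, rfl⟩)
  choose f' hf' using hmem
  refine ⟨f', fun i => ?_, fun x h => ?_⟩
  · simp only [hf']
    exact hg' i
  · rw [HasDirDeriv, hι.isInducing.tendsto_nhds_iff, hf']
    exact hlim x h

theorem isCrOn_top_of_forall_mem_polyMaps [IsTopologicalRing B] [ContinuousSMul L B]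
    (ι : F →ₗ[L] (I → B)) (hι : IsClosedEmbedding ι) {f : X → F}
    (hf : ∀ i, (fun x => ι (f x) i) ∈ polyMaps L K X B) (U : Set X) : IsCrOn L ⊤ f U := by
  let P : ℕ → Type _ := fun k =>
    {D : X × (Fin k → X) → F // ∀ i, (fun p => ι (D p) i) ∈ polyMaps L K (X × (Fin k → X)) B}
  have step : ∀ (k : ℕ) (D : P k), ∃ D' : P (k + 1), ∀ (x : X) (y : Fin k → X) (h : X),
      HasDirDeriv L (fun z => D.1 (z, y)) x h
        (D'.1 (x, Fin.snoc (α := fun _ => X) y h)) := by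
    intro k D
    obtain ⟨D', hD', hD⟩ := exists_dirDeriv_of_forall_mem_polyMaps ι hι D.2
    -- The next derivative varies only the base point: T sends (x, (y, h)) to the point (x, y) with
    -- direction (h, 0).
    let T : X × (Fin (k + 1) → X) →L[L] (X × (Fin k → X)) × (X × (Fin k → X)) :=
      ((ContinuousLinearMap.fst L X _).prod (ContinuousLinearMap.pi fun i : Fin k =>
        (ContinuousLinearMap.proj (R := L) (φ := fun _ : Fin (k + 1) => X) i.castSucc).comp
          (ContinuousLinearMap.snd L X _))).prod
      (((ContinuousLinearMap.proj (R := L) (φ := fun _ : Fin (k + 1) => X) (Fin.last k)).comp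
          (ContinuousLinearMap.snd L X _)).prod 0)
    refine ⟨⟨D' ∘ T, fun i => comp_mem_polyMaps (hD' i) T⟩, fun x y h => ?_⟩
    have hT : T (x, Fin.snoc (α := fun _ => X) y h) = ((x, y), (h, 0)) := by
      refine Prod.ext (Prod.ext rfl (funext fun i => ?_)) (Prod.ext ?_ rfl)
      · exact Fin.snoc_castSucc (α := fun _ => X) h y i
      · exact Fin.snoc_last (α := fun _ => X) h y
    change HasDirDeriv L _ x h (D' (T (x, Fin.snoc (α := fun _ => X) y h)))
    rw [hT]
    exact (hD (x, y) (h, 0)).prodMk_left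
  choose s hs using step
  let d : ∀ k, P k := fun k => Nat.rec
    (⟨fun p => f p.1, fun i =>
      comp_mem_polyMaps (hf i) (ContinuousLinearMap.fst L X (Fin 0 → X))⟩ : P 0) s k
  refine ⟨fun k x y => (d k).1 (x, y), fun x _ y => rfl, fun k _ x _ y h => hs k (d k) x y h,
    fun k _ => Continuous.continuousOn ?_⟩
  rw [hι.isInducing.continuous_iff, continuous_pi_iff]
  exact fun i => continuous_of_mem_polyMaps ((d k).2 i)

theorem isCrOn_top_of_isClosedEmbedding [IsTopologicalRing B] [ContinuousSMul L B]
    {ι : F → I → B} (hadd : ∀ u v, ι (u + v) = ι u + ι v)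
    (hsmul : ∀ (c : L) u, ι (c • u) = c • ι u) (hι : IsClosedEmbedding ι) {f : X → F}
    (hf : ∀ i, (fun x => ι (f x) i) ∈ polyMaps L K X B) (U : Set X) : IsCrOn L ⊤ f U :=
  isCrOn_top_of_forall_mem_polyMaps ⟨⟨ι, hadd⟩, hsmul⟩ hι hf U

end PolyMaps

/-! ### Continuous linear maps are smooth and analytic. -/

section LinearMaps

theorem ContinuousLinearMap.isCrOn {L : Type*} [RCLike L] {E F : Type*} [AddCommGroup E]
    [Module L E] [TopologicalSpace E] [AddCommGroup F] [Module L F] [TopologicalSpace F]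
    (T : E →L[L] F) (r : ℕ∞) (U : Set E) : IsCrOn L r T U := by
  refine ⟨fun k x y => match k, y with
    | 0, _ => T x
    | 1, y => T (y 0)
    | _ + 2, _ => 0, fun _ _ _ => rfl, fun k _ x _ y h => ?_, fun k _ => ?_⟩
  · match k, y with
    | 0, y => exact HasDirDeriv.linearMap T.toLinearMap x h
    | 1, y => exact HasDirDeriv.const _ x h
    | k + 2, y => exact HasDirDeriv.const _ x h
  · apply Continuous.continuousOn
    match k with
    | 0 => exact T.continuous.comp continuous_fst
    | 1 => exact T.continuous.comp ((continuous_apply 0).comp continuous_snd)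
    | k + 2 => exact continuous_const

theorem IsCrOn.of_le {L : Type*} [RCLike L] {E F : Type*} [AddCommGroup E]
    [Module L E] [TopologicalSpace E] [AddCommGroup F] [Module L F] [TopologicalSpace F]
    {f : E → F} {U : Set E} {r s : ℕ∞} (hf : IsCrOn L s f U) (hrs : r ≤ s) : IsCrOn L r f U := by
  obtain ⟨d, h0, h1, h2⟩ := hf
  exact ⟨d, h0, fun k hk => h1 k (hk.trans_le hrs), fun k hk => h2 k (hk.trans hrs)⟩

variable {E F : Type*} [AddCommGroup E] [Module ℝ E] [TopologicalSpace E] [AddCommGroup F]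
  [Module ℝ F] [TopologicalSpace F]

theorem ContinuousLinearMap.isRealAnalyticOn (T : E →L[ℝ] F) (U : Set E) :
    IsRealAnalyticOn T U := by
  let S : Complexification E →L[ℂ] Complexification F :=
    { toFun := fun p => (T p.1, T p.2)
      map_add' := fun p q => Prod.ext (map_add T p.1 q.1) (map_add T p.2 q.2)
      map_smul' := fun z p => by
        refine Prod.ext ?_ ?_
        · change T (z.re • p.1 - z.im • p.2) = z.re • T p.1 - z.im • T p.2
          simp
        · change T (z.re • p.2 + z.im • p.1) = z.re • T p.2 + z.im • T p.1
          simp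
      cont := (T.continuous.comp continuous_fst).prodMk (T.continuous.comp continuous_snd) }
  exact ⟨univ, S, isOpen_univ, fun _ _ => trivial, S.isCrOn ⊤ univ,
    fun x _ => Prod.ext rfl (map_zero T)⟩

theorem ContinuousLinearMap.isOfClassOn {𝕜 : Type*} [RCLike 𝕜] [Module 𝕜 E]
    [IsScalarTower ℝ 𝕜 E] [Module 𝕜 F] [IsScalarTower ℝ 𝕜 F] (T : E →L[𝕜] F) (r : WithTop ℕ∞)
    (U : Set E) : IsOfClassOn 𝕜 r T U :=
  ⟨fun _ => ⟨fun _ => (T.restrictScalars ℝ).isRealAnalyticOn U, fun _ => T.isCrOn ⊤ U⟩,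
    fun k _ => T.isCrOn k U⟩

end LinearMaps

/-! ### Pointwise membership in a subalgebra of functions -/

section Pointwise

variable {K H B X : Type*} [Field K] [Ring H] [HopfAlgebra K H] [CommRing B] [Algebra K B]
  {S : Subalgebra K (X → B)}

/-- The subalgebra S is left open so that one computation serves twice: with continuous functions
for the topology, and with `polyMaps` for differentiability. -/
theorem convMul_mem_subalgebra {f g : X → WithConv (H →ₗ[K] B)}
    (hf : ∀ h, (fun x => f x h) ∈ S) (hg : ∀ h, (fun x => g x h) ∈ S) (h : H) :
    (fun x => (f x * g x) h) ∈ S := by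
  have e : (fun x => (f x * g x) h) =
      ∑ i ∈ (Coalgebra.Repr.arbitrary K h).index,
        (fun x => f x ((Coalgebra.Repr.arbitrary K h).left i)) *
          (fun x => g x ((Coalgebra.Repr.arbitrary K h).right i)) := by
    ext x
    rw [(Coalgebra.Repr.arbitrary K h).convMul_apply, Finset.sum_apply]
    rfl
  rw [e]
  exact Subalgebra.sum_mem _ fun i _ => Subalgebra.mul_mem _ (hf _) (hg _)

theorem convOne_mem_subalgebra (h : H) :
    (fun _ : X => (1 : WithConv (H →ₗ[K] B)) h) ∈ S :=
  Subalgebra.algebraMap_mem S (Coalgebra.counit (R := K) h)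

theorem convPow_mem_subalgebra {f : X → WithConv (H →ₗ[K] B)} (hf : ∀ h, (fun x => f x h) ∈ S)
    (n : ℕ) (h : H) : (fun x => (f x ^ n) h) ∈ S := by
  induction n generalizing h with
  | zero =>
    simp only [pow_zero]
    exact convOne_mem_subalgebra h
  | succ n ih =>
    simp only [pow_succ]
    exact convMul_mem_subalgebra ih hf h

namespace IsConnectedHopfGrading

variable {𝒜 : ℕ → Submodule K H} (h𝒜 : IsConnectedHopfGrading 𝒜)

theorem convEval_mem_subalgebra {f : X → WithConv (H →ₗ[K] B)}
    (hf : ∀ h, (fun x => f x h) ∈ S) (hf1 : ∀ x, f x ∈ convFiltration 𝒜 B 1)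
    (p : PowerSeries K) (h : H) : (fun x => h𝒜.convEval (f x) p h) ∈ S := by
  obtain ⟨N, hN⟩ := h𝒜.exists_convEval_apply B h
  have e : (fun x => h𝒜.convEval (f x) p h) =
      ∑ k ∈ Finset.range N, PowerSeries.coeff k p • fun x => (f x ^ k) h := by
    ext x
    rw [(hN _ (hf1 x)).2, Finset.sum_apply]
    rfl
  rw [e]
  exact Subalgebra.sum_mem _ fun k _ => Subalgebra.smul_mem _ (convPow_mem_subalgebra hf k h) _

variable [CharZero K]

theorem charExp_mem_subalgebra {u : X → InfChar K H B}
    (hu : ∀ h, (fun x => (u x : H →ₗ[K] B) h) ∈ S) (h : H) :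
    (fun x => h𝒜.charExp (u x) h) ∈ S :=
  h𝒜.convEval_mem_subalgebra (f := fun x => WithConv.toConv (u x : H →ₗ[K] B)) hu
    (fun x => h𝒜.infChar_mem_convFiltration (u x)) _ h

theorem charExp_symm_mem_subalgebra {φ : X → CharGroup K H B}
    (hφ : ∀ h, (fun x => φ x h) ∈ S) (h : H) :
    (fun x => (h𝒜.charExp.symm (φ x) : H →ₗ[K] B) h) ∈ S :=
  h𝒜.convEval_mem_subalgebra (f := fun x => WithConv.toConv (φ x).ofConv.toLinearMap - 1)
    (fun h => Subalgebra.sub_mem _ (hφ h) (convOne_mem_subalgebra h))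
    (fun x => h𝒜.char_sub_one_mem_convFiltration (φ x).ofConv) _ h

/-- The Baker-Campbell-Hausdorff product `log (exp ψ₁ * exp ψ₂)`. -/
noncomputable def bch (ψ₁ ψ₂ : InfChar K H B) : InfChar K H B :=
  h𝒜.charExp.symm (h𝒜.charExp ψ₁ * h𝒜.charExp ψ₂)

theorem bch_mem_subalgebra {u v : X → InfChar K H B}
    (hu : ∀ h, (fun x => (u x : H →ₗ[K] B) h) ∈ S)
    (hv : ∀ h, (fun x => (v x : H →ₗ[K] B) h) ∈ S) (h : H) :
    (fun x => (h𝒜.bch (u x) (v x) : H →ₗ[K] B) h) ∈ S :=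
  h𝒜.charExp_symm_mem_subalgebra (fun h => convMul_mem_subalgebra
    (f := fun x => WithConv.toConv (h𝒜.charExp (u x)).ofConv.toLinearMap)
    (g := fun x => WithConv.toConv (h𝒜.charExp (v x)).ofConv.toLinearMap)
    (h𝒜.charExp_mem_subalgebra hu) (h𝒜.charExp_mem_subalgebra hv) h) h

end IsConnectedHopfGrading

end Pointwise

/-! ### Naturality in the target algebra -/

section Naturality

variable {K H B B' : Type*} [Field K] [Ring H] [HopfAlgebra K H] [CommRing B] [Algebra K B]
  [CommRing B'] [Algebra K B'] (θ : B →ₐ[K] B')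

/-- Composition with a homomorphism of algebras, on convolution algebras. -/
def convPostcomp (H : Type*) [Ring H] [HopfAlgebra K H] (θ : B →ₐ[K] B') :
    WithConv (H →ₗ[K] B) →ₐ[K] WithConv (H →ₗ[K] B') where
  toFun f := WithConv.toConv (θ.toLinearMap ∘ₗ f.ofConv)
  map_one' := by
    ext h
    simp
  map_mul' f g := congrArg WithConv.toConv (LinearMap.algHom_comp_convMul_distrib θ f g)
  map_zero' := by
    ext h
    simp
  map_add' f g := by
    ext h
    simp
  commutes' c := by
    ext h
    simp

theorem convPostcomp_apply (f : WithConv (H →ₗ[K] B)) (h : H) :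
    convPostcomp H θ f h = θ (f h) := rfl

/-- Composition of an infinitesimal character with a homomorphism of algebras. -/
def InfChar.postcomp (ψ : InfChar K H B) : InfChar K H B' :=
  ⟨θ.toLinearMap ∘ₗ (ψ : H →ₗ[K] B), fun a b => by
    have := ψ.2 a b
    simp [this]⟩

namespace IsConnectedHopfGrading

variable {𝒜 : ℕ → Submodule K H} (h𝒜 : IsConnectedHopfGrading 𝒜)

theorem convPostcomp_convEval (x : WithConv (H →ₗ[K] B)) (p : PowerSeries K) :
    convPostcomp H θ (h𝒜.convEval x p) = h𝒜.convEval (convPostcomp H θ x) p := by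
  refine h𝒜.eq_of_forall_sub_mem fun n k _ h hh => ?_
  rw [WithConv.ofConv_sub, LinearMap.sub_apply, h𝒜.convEval_apply_of_mem _ p hh,
    convPostcomp_apply, h𝒜.convEval_apply_of_mem _ p hh, Polynomial.aeval_algHom_apply,
    convPostcomp_apply, sub_self]

variable [CharZero K]

/-- Applied to the inclusion of B into its complexification, this shows that the complexified
product extends the original one. -/
theorem bch_postcomp (ψ₁ ψ₂ : InfChar K H B) :
    h𝒜.bch (InfChar.postcomp θ ψ₁) (InfChar.postcomp θ ψ₂) = InfChar.postcomp θ (h𝒜.bch ψ₁ ψ₂) := by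
  have key : ∀ ψ₁ ψ₂ : InfChar K H B, convPostcomp H θ (h𝒜.convLog
      (h𝒜.convExp (WithConv.toConv (ψ₁ : H →ₗ[K] B)) *
        h𝒜.convExp (WithConv.toConv (ψ₂ : H →ₗ[K] B)))) =
      h𝒜.convLog
      (h𝒜.convExp (convPostcomp H θ (WithConv.toConv (ψ₁ : H →ₗ[K] B))) *
        h𝒜.convExp (convPostcomp H θ (WithConv.toConv (ψ₂ : H →ₗ[K] B)))) := by
    intro ψ₁ ψ₂
    simp only [convLog, convExp, convPostcomp_convEval, map_sub, map_mul, map_one]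
  exact Subtype.ext (congrArg WithConv.ofConv (key ψ₁ ψ₂).symm)

end IsConnectedHopfGrading

end Naturality

/-! ### The complexification of a real algebra -/

namespace Complexification

variable {B : Type*} [CommRing B]

instance : CommRing (Complexification B) where
  __ := (inferInstance : AddCommGroup (Complexification B))
  mul a b := (a.1 * b.1 - a.2 * b.2, a.1 * b.2 + a.2 * b.1)
  one := (1, 0)
  zero_mul a := Prod.ext (show 0 * a.1 - 0 * a.2 = 0 by ring) (show 0 * a.2 + 0 * a.1 = 0 by ring)
  mul_zero a := Prod.ext (show a.1 * 0 - a.2 * 0 = 0 by ring) (show a.1 * 0 + a.2 * 0 = 0 by ring)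
  one_mul a := Prod.ext (show 1 * a.1 - 0 * a.2 = a.1 by ring)
    (show 1 * a.2 + 0 * a.1 = a.2 by ring)
  mul_one a := Prod.ext (show a.1 * 1 - a.2 * 0 = a.1 by ring)
    (show a.1 * 0 + a.2 * 1 = a.2 by ring)
  mul_comm a b := Prod.ext (show a.1 * b.1 - a.2 * b.2 = b.1 * a.1 - b.2 * a.2 by ring)
    (show a.1 * b.2 + a.2 * b.1 = b.1 * a.2 + b.2 * a.1 by ring)
  mul_assoc a b c := Prod.ext
    (show (a.1 * b.1 - a.2 * b.2) * c.1 - (a.1 * b.2 + a.2 * b.1) * c.2 =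
      a.1 * (b.1 * c.1 - b.2 * c.2) - a.2 * (b.1 * c.2 + b.2 * c.1) by ring)
    (show (a.1 * b.1 - a.2 * b.2) * c.2 + (a.1 * b.2 + a.2 * b.1) * c.1 =
      a.1 * (b.1 * c.2 + b.2 * c.1) + a.2 * (b.1 * c.1 - b.2 * c.2) by ring)
  left_distrib a b c := Prod.ext
    (show a.1 * (b.1 + c.1) - a.2 * (b.2 + c.2) =
      (a.1 * b.1 - a.2 * b.2) + (a.1 * c.1 - a.2 * c.2) by ring)
    (show a.1 * (b.2 + c.2) + a.2 * (b.1 + c.1) =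
      (a.1 * b.2 + a.2 * b.1) + (a.1 * c.2 + a.2 * c.1) by ring)
  right_distrib a b c := Prod.ext
    (show (a.1 + b.1) * c.1 - (a.2 + b.2) * c.2 =
      (a.1 * c.1 - a.2 * c.2) + (b.1 * c.1 - b.2 * c.2) by ring)
    (show (a.1 + b.1) * c.2 + (a.2 + b.2) * c.1 =
      (a.1 * c.2 + a.2 * c.1) + (b.1 * c.2 + b.2 * c.1) by ring)

instance [Module ℝ B] [IsScalarTower ℝ B B] : Algebra ℂ (Complexification B) :=
  Algebra.ofModule
    (fun z a b => Prod.ext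
      (show (z.re • a.1 - z.im • a.2) * b.1 - (z.re • a.2 + z.im • a.1) * b.2 =
        z.re • (a.1 * b.1 - a.2 * b.2) - z.im • (a.1 * b.2 + a.2 * b.1) by
          simp only [sub_mul, add_mul, smul_mul_assoc]
          module)
      (show (z.re • a.1 - z.im • a.2) * b.2 + (z.re • a.2 + z.im • a.1) * b.1 =
        z.re • (a.1 * b.2 + a.2 * b.1) + z.im • (a.1 * b.1 - a.2 * b.2) by
          simp only [sub_mul, add_mul, smul_mul_assoc]
          module))
    (fun z a b => Prod.ext
      (show a.1 * (z.re • b.1 - z.im • b.2) - a.2 * (z.re • b.2 + z.im • b.1) =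
        z.re • (a.1 * b.1 - a.2 * b.2) - z.im • (a.1 * b.2 + a.2 * b.1) by
          simp only [mul_sub, mul_add, mul_smul_comm]
          module)
      (show a.1 * (z.re • b.2 + z.im • b.1) + a.2 * (z.re • b.1 - z.im • b.2) =
        z.re • (a.1 * b.2 + a.2 * b.1) + z.im • (a.1 * b.1 - a.2 * b.2) by
          simp only [mul_sub, mul_add, mul_smul_comm]
          module))

/-- The complexification of a `K`-algebra as a `K`-algebra. -/
abbrev algebraOfField (K B : Type*) [Field K] [CommRing B] [Algebra K B] :
    Algebra K (Complexification B) :=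
  let _ : Module K (Complexification B) := inferInstanceAs (Module K (B × B))
  Algebra.ofModule
    (fun c a b => Prod.ext
      (show c • a.1 * b.1 - c • a.2 * b.2 = c • (a.1 * b.1 - a.2 * b.2) by
        simp only [smul_sub, smul_mul_assoc])
      (show c • a.1 * b.2 + c • a.2 * b.1 = c • (a.1 * b.2 + a.2 * b.1) by
        simp only [smul_add, smul_mul_assoc]))
    (fun c a b => Prod.ext
      (show a.1 * c • b.1 - a.2 * c • b.2 = c • (a.1 * b.1 - a.2 * b.2) by
        simp only [smul_sub, mul_smul_comm])
      (show a.1 * c • b.2 + a.2 * c • b.1 = c • (a.1 * b.2 + a.2 * b.1) by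
        simp only [smul_add, mul_smul_comm]))

instance [TopologicalSpace B] [T2Space B] : T2Space (Complexification B) :=
  inferInstanceAs (T2Space (B × B))

instance [TopologicalSpace B] [IsTopologicalRing B] : IsTopologicalRing (Complexification B) where
  continuous_add := show Continuous fun p : (B × B) × (B × B) => p.1 + p.2 from continuous_add
  continuous_mul := by
    have h1 : Continuous fun p : (B × B) × (B × B) =>
        (p.1.1 * p.2.1 - p.1.2 * p.2.2, p.1.1 * p.2.2 + p.1.2 * p.2.1) := by fun_prop
    exact h1
  continuous_neg := show Continuous fun p : B × B => -p from continuous_neg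

instance {E : Type*} [AddCommGroup E] [Module ℝ E] [TopologicalSpace E] [IsTopologicalAddGroup E]
    [ContinuousSMul ℝ E] : ContinuousSMul ℂ (Complexification E) where
  continuous_smul := by
    have h1 : Continuous fun p : ℂ × (E × E) =>
        (p.1.re • p.2.1 - p.1.im • p.2.2, p.1.re • p.2.2 + p.1.im • p.2.1) := by fun_prop
    exact h1

end Complexification

/-! ### The topology of pointwise convergence -/

section Topologies

variable {K H B : Type*} [Field K] [Ring H] [HopfAlgebra K H] [CommRing B] [Algebra K B]
  [TopologicalSpace B]

theorem InfChar.isInducing_coe :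
    IsInducing fun (ψ : InfChar K H B) (h : H) => (ψ : H →ₗ[K] B) h :=
  (IsInducing.mk rfl : IsInducing fun (φ : H →ₗ[K] B) (h : H) => φ h).comp IsInducing.subtypeVal

theorem CharGroup.isInducing_coe :
    IsInducing fun (φ : CharGroup K H B) (h : H) => φ.ofConv h := ⟨rfl⟩

omit [TopologicalSpace B] in
theorem CharGroup.coe_injective :
    Function.Injective fun (φ : CharGroup K H B) (h : H) => φ.ofConv h :=
  fun _ _ h => WithConv.ofConv_injective (DFunLike.coe_injective h)

instance [T2Space B] : T2Space (CharGroup K H B) :=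
  T2Space.of_injective_continuous CharGroup.coe_injective CharGroup.isInducing_coe.continuous

theorem InfChar.continuous_apply (h : H) :
    Continuous fun ψ : InfChar K H B => (ψ : H →ₗ[K] B) h :=
  (_root_.continuous_apply h).comp InfChar.isInducing_coe.continuous

/-- Linearity and the Leibniz identity are equations between continuous functions of finitely many
evaluations, so they cut out a closed set in B^H. -/
theorem InfChar.isClosedEmbedding_coe [T2Space B] [IsTopologicalRing B]
    [ContinuousConstSMul K B] :
    IsClosedEmbedding fun (ψ : InfChar K H B) (h : H) => (ψ : H →ₗ[K] B) h := by
  refine ⟨⟨InfChar.isInducing_coe, fun _ _ h => Subtype.ext (DFunLike.coe_injective h)⟩, ?_⟩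
  have e : range (fun (ψ : InfChar K H B) (h : H) => (ψ : H →ₗ[K] B) h) =
      (⋂ (a : H) (b : H), {g : H → B | g (a + b) = g a + g b}) ∩
      (⋂ (c : K) (a : H), {g : H → B | g (c • a) = c • g a}) ∩
      (⋂ (a : H) (b : H), {g : H → B | g (a * b) =
        Coalgebra.counit (R := K) b • g a + Coalgebra.counit (R := K) a • g b}) := by
    ext g
    simp only [mem_range, mem_inter_iff, mem_iInter, mem_ofPred_eq]
    constructor
    · rintro ⟨ψ, rfl⟩
      exact ⟨⟨fun a b => map_add _ a b, fun c a => map_smul _ c a⟩, ψ.2⟩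
    · rintro ⟨⟨h1, h2⟩, h3⟩
      exact ⟨⟨⟨⟨g, h1⟩, h2⟩, h3⟩, rfl⟩
  rw [e]
  refine ((isClosed_iInter fun a => isClosed_iInter fun b => ?_).inter
    (isClosed_iInter fun c => isClosed_iInter fun a => ?_)).inter
    (isClosed_iInter fun a => isClosed_iInter fun b => ?_)
  · exact isClosed_eq (by fun_prop) (by fun_prop)
  · exact isClosed_eq (by fun_prop) (by fun_prop)
  · exact isClosed_eq (by fun_prop) (by fun_prop)

instance [T2Space B] : T2Space (InfChar K H B) :=
  T2Space.of_injective_continuous (fun _ _ h => Subtype.ext (DFunLike.coe_injective h))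
    InfChar.isInducing_coe.continuous

instance [IsTopologicalRing B] : IsTopologicalAddGroup (InfChar K H B) :=
  let T : InfChar K H B →+ (H → B) :=
    { toFun := fun ψ h => (ψ : H →ₗ[K] B) h
      map_zero' := rfl
      map_add' := fun _ _ => rfl }
  (InfChar.isInducing_coe : IsInducing T).topologicalAddGroup T

instance [TopologicalSpace K] [ContinuousSMul K B] : ContinuousSMul K (InfChar K H B) :=
  (InfChar.isInducing_coe : IsInducing _).continuousSMul continuous_id rfl

end Topologies

section RealTopologies

variable {𝕜 H B : Type*} [RCLike 𝕜] [Ring H] [HopfAlgebra 𝕜 H] [CommRing B] [Algebra 𝕜 B]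
  [Module ℝ B] [IsScalarTower ℝ 𝕜 B] [TopologicalSpace B]

instance [ContinuousSMul ℝ B] : ContinuousSMul ℝ (InfChar 𝕜 H B) :=
  (InfChar.isInducing_coe : IsInducing _).continuousSMul continuous_id rfl

theorem InfChar.locallyConvexSpace [LocallyConvexSpace ℝ B] [IsTopologicalRing B]
    [ContinuousSMul ℝ B] : LocallyConvexSpace ℝ (InfChar 𝕜 H B) :=
  let T : InfChar 𝕜 H B →ₗ[ℝ] (H → B) :=
    { toFun := fun ψ h => (ψ : H →ₗ[𝕜] B) h
      map_smul' := fun _ _ => rfl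
      map_add' := fun _ _ => rfl }
  IsInducing.locallyConvexSpace (f := T) InfChar.isInducing_coe

end RealTopologies

/-! ### The exponential homeomorphism -/

namespace IsConnectedHopfGrading

variable {K H B : Type*} [Field K] [CharZero K] [Ring H] [HopfAlgebra K H] [CommRing B]
  [Algebra K B] [TopologicalSpace B] [IsTopologicalRing B] {𝒜 : ℕ → Submodule K H}
  (h𝒜 : IsConnectedHopfGrading 𝒜)

/-- The exponential homeomorphism from infinitesimal characters to characters. -/
noncomputable def charExpHomeomorph : InfChar K H B ≃ₜ CharGroup K H B where
  toEquiv := h𝒜.charExp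
  continuous_toFun := by
    rw [CharGroup.isInducing_coe.continuous_iff, continuous_pi_iff]
    exact h𝒜.charExp_mem_subalgebra (S := (continuousSubalgebra : Subalgebra K (InfChar K H B → B)))
      (u := id) InfChar.continuous_apply
  continuous_invFun := by
    rw [InfChar.isInducing_coe.continuous_iff, continuous_pi_iff]
    exact h𝒜.charExp_symm_mem_subalgebra
      (S := (continuousSubalgebra : Subalgebra K (CharGroup K H B → B)))
      (φ := id) fun h => (continuous_apply h).comp CharGroup.isInducing_coe.continuous

end IsConnectedHopfGrading

/-! ### Analyticity of the Baker-Campbell-Hausdorff product -/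

section BCH

variable {𝕜 H B : Type*} [RCLike 𝕜] [Ring H] [HopfAlgebra 𝕜 H] [CommRing B] [Algebra 𝕜 B]
  [TopologicalSpace B] [IsTopologicalRing B] [T2Space B]
  {𝒜 : ℕ → Submodule 𝕜 H} (h𝒜 : IsConnectedHopfGrading 𝒜)

namespace IsConnectedHopfGrading

theorem isCrOn_top_bch [ContinuousSMul 𝕜 B] (U : Set (InfChar 𝕜 H B × InfChar 𝕜 H B)) :
    IsCrOn 𝕜 ⊤ (fun p : InfChar 𝕜 H B × InfChar 𝕜 H B => h𝒜.bch p.1 p.2) U := by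
  have h1 : ∀ h, (fun p : InfChar 𝕜 H B × InfChar 𝕜 H B => (p.1 : H →ₗ[𝕜] B) h) ∈
      polyMaps 𝕜 𝕜 (InfChar 𝕜 H B × InfChar 𝕜 H B) B :=
    fun h => mem_polyMaps_of_linear (fun _ _ => rfl) (fun _ _ => rfl)
      ((InfChar.continuous_apply h).comp continuous_fst)
  have h2 : ∀ h, (fun p : InfChar 𝕜 H B × InfChar 𝕜 H B => (p.2 : H →ₗ[𝕜] B) h) ∈
      polyMaps 𝕜 𝕜 (InfChar 𝕜 H B × InfChar 𝕜 H B) B :=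
    fun h => mem_polyMaps_of_linear (fun _ _ => rfl) (fun _ _ => rfl)
      ((InfChar.continuous_apply h).comp continuous_snd)
  exact isCrOn_top_of_isClosedEmbedding (fun _ _ => rfl) (fun _ _ => rfl)
    InfChar.isClosedEmbedding_coe (h𝒜.bch_mem_subalgebra h1 h2) U

end IsConnectedHopfGrading

-- Kept local: for 𝕜 = ℂ the componentwise action differs from the ℂ-structure in which i sends (u,
-- v) to (-v, u).
attribute [local instance] Complexification.algebraOfField

/-- The pair of infinitesimal characters `(ψ₁, ψ₂)` as an infinitesimal character `ψ₁ + i ψ₂`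
with values in the complexification. -/
def InfChar.complexify (p : Complexification (InfChar 𝕜 H B)) :
    InfChar 𝕜 H (Complexification B) :=
  ⟨{ toFun := fun h => ((p.1 : H →ₗ[𝕜] B) h, (p.2 : H →ₗ[𝕜] B) h)
     map_add' := fun a b => Prod.ext (map_add _ a b) (map_add _ a b)
     map_smul' := fun c a => Prod.ext (map_smul _ c a) (map_smul _ c a) },
    fun a b => Prod.ext (p.1.2 a b) (p.2.2 a b)⟩

/-- The real and imaginary part of an infinitesimal character with values in the
complexification. -/
def InfChar.decomplexify (ψ : InfChar 𝕜 H (Complexification B)) :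
    Complexification (InfChar 𝕜 H B) :=
  (⟨{ toFun := fun h => ((ψ : H →ₗ[𝕜] Complexification B) h).1
      map_add' := fun a b => congrArg Prod.fst (map_add (ψ : H →ₗ[𝕜] Complexification B) a b)
      map_smul' := fun c a =>
        congrArg Prod.fst (map_smul (ψ : H →ₗ[𝕜] Complexification B) c a) },
    fun a b => congrArg Prod.fst (ψ.2 a b)⟩,
   ⟨{ toFun := fun h => ((ψ : H →ₗ[𝕜] Complexification B) h).2
      map_add' := fun a b => congrArg Prod.snd (map_add (ψ : H →ₗ[𝕜] Complexification B) a b)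
      map_smul' := fun c a =>
        congrArg Prod.snd (map_smul (ψ : H →ₗ[𝕜] Complexification B) c a) },
    fun a b => congrArg Prod.snd (ψ.2 a b)⟩)

/-- The inclusion of an algebra into its complexification. -/
def Complexification.ofRealAlgHom (𝕜 B : Type*) [Field 𝕜] [CommRing B] [Algebra 𝕜 B] :
    B →ₐ[𝕜] Complexification B where
  toFun := Complexification.ofReal
  map_one' := rfl
  map_mul' a b := Prod.ext (show a * b = a * b - 0 * 0 by ring) (show 0 = a * 0 + 0 * b by ring)
  map_zero' := rfl
  map_add' a b := Prod.ext rfl (show (0 : B) = 0 + 0 by ring)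
  commutes' c := Prod.ext
    (show algebraMap 𝕜 B c = c • (1 : B) from Algebra.algebraMap_eq_smul_one c)
    (show (0 : B) = c • (0 : B) from (smul_zero c).symm)

variable [Module ℝ B] [IsScalarTower ℝ 𝕜 B]

namespace IsConnectedHopfGrading

/-- A pair of infinitesimal characters is one with values in the complexification of B. The
extension is the product for that target algebra, whose coordinates are polynomial in complex-linear
evaluations. -/
theorem isRealAnalyticOn_bch [ContinuousSMul 𝕜 B] [ContinuousSMul ℝ B]
    (U : Set (InfChar 𝕜 H B × InfChar 𝕜 H B)) :
    IsRealAnalyticOn (fun p : InfChar 𝕜 H B × InfChar 𝕜 H B => h𝒜.bch p.1 p.2) U := by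
  have : IsScalarTower ℝ B B := ⟨fun r a b => by
    rw [← algebraMap_smul 𝕜 r a, smul_eq_mul, smul_eq_mul, smul_mul_assoc, algebraMap_smul]⟩
  let ι : Complexification (InfChar 𝕜 H B) →ₗ[ℂ] (H → Complexification B) :=
    { toFun := fun p h => ((p.1 : H →ₗ[𝕜] B) h, (p.2 : H →ₗ[𝕜] B) h)
      map_smul' := fun _ _ => rfl
      map_add' := fun _ _ => rfl }
  have hι : IsClosedEmbedding ι := by
    have h1 := (InfChar.isClosedEmbedding_coe (K := 𝕜) (H := H) (B := B)).prodMap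
      (InfChar.isClosedEmbedding_coe (K := 𝕜) (H := H) (B := B))
    let e : (H → B) × (H → B) ≃ₜ (H → B × B) :=
      { toFun := fun p h => (p.1 h, p.2 h)
        invFun := fun g => (fun h => (g h).1, fun h => (g h).2)
        left_inv := fun _ => rfl
        right_inv := fun _ => rfl
        continuous_toFun := by fun_prop
        continuous_invFun := by fun_prop }
    exact e.isClosedEmbedding.comp h1
  let ev₁ : H → Complexification (InfChar 𝕜 H B × InfChar 𝕜 H B) →L[ℂ] Complexification B :=
    fun h =>
    { toFun := fun p => ((p.1.1 : H →ₗ[𝕜] B) h, (p.2.1 : H →ₗ[𝕜] B) h)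
      map_smul' := fun _ _ => rfl
      map_add' := fun _ _ => rfl
      cont := ((InfChar.continuous_apply h).comp (continuous_fst.comp continuous_fst)).prodMk
        ((InfChar.continuous_apply h).comp (continuous_fst.comp continuous_snd)) }
  let ev₂ : H → Complexification (InfChar 𝕜 H B × InfChar 𝕜 H B) →L[ℂ] Complexification B :=
    fun h =>
    { toFun := fun p => ((p.1.2 : H →ₗ[𝕜] B) h, (p.2.2 : H →ₗ[𝕜] B) h)
      map_smul' := fun _ _ => rfl
      map_add' := fun _ _ => rfl
      cont := ((InfChar.continuous_apply h).comp (continuous_snd.comp continuous_fst)).prodMk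
        ((InfChar.continuous_apply h).comp (continuous_snd.comp continuous_snd)) }
  let g : Complexification (InfChar 𝕜 H B × InfChar 𝕜 H B) → Complexification (InfChar 𝕜 H B) :=
    fun p => InfChar.decomplexify
      (h𝒜.bch (InfChar.complexify (p.1.1, p.2.1)) (InfChar.complexify (p.1.2, p.2.2)))
  refine ⟨univ, g, isOpen_univ, fun _ _ => trivial, ?_, fun x _ => ?_⟩
  · exact isCrOn_top_of_forall_mem_polyMaps (K := 𝕜) ι hι
      (h𝒜.bch_mem_subalgebra
        (fun h => continuousLinearMap_mem_polyMaps (ev₁ h))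
        (fun h => continuousLinearMap_mem_polyMaps (ev₂ h))) univ
  · have h1 : ∀ ψ : InfChar 𝕜 H B, InfChar.complexify (ψ, 0) =
        InfChar.postcomp (Complexification.ofRealAlgHom 𝕜 B) ψ := fun ψ => rfl
    change InfChar.decomplexify (h𝒜.bch (InfChar.complexify (x.1, 0))
      (InfChar.complexify (x.2, 0))) = _
    rw [h1, h1, bch_postcomp]
    rfl

theorem isOfClassOn_bch [ContinuousSMul 𝕜 B] [ContinuousSMul ℝ B] {r : WithTop ℕ∞}
    (U : Set (InfChar 𝕜 H B × InfChar 𝕜 H B)) :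
    IsOfClassOn 𝕜 r (fun p : InfChar 𝕜 H B × InfChar 𝕜 H B => h𝒜.bch p.1 p.2) U :=
  ⟨fun _ => ⟨fun _ => h𝒜.isRealAnalyticOn_bch U, fun _ => h𝒜.isCrOn_top_bch U⟩,
    fun _ _ => (h𝒜.isCrOn_top_bch U).of_le le_top⟩

end IsConnectedHopfGrading

end BCH

/-! ### The Lie group structure -/

theorem isOfClassOn_neg {𝕜 E : Type*} [RCLike 𝕜] [AddCommGroup E] [Module 𝕜 E] [Module ℝ E]
    [IsScalarTower ℝ 𝕜 E] [TopologicalSpace E] [IsTopologicalAddGroup E] (r : WithTop ℕ∞)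
    (U : Set E) : IsOfClassOn 𝕜 r (fun x : E => -x) U :=
  (-ContinuousLinearMap.id 𝕜 E).isOfClassOn r U

theorem HasDirDeriv.smul_const {E : Type*} [AddCommGroup E] [Module ℝ E] [TopologicalSpace E]
    (v : E) : HasDirDeriv ℝ (fun t : ℝ => t • v) 0 1 v := by
  have h := HasDirDeriv.linearMap (L := ℝ) (LinearMap.toSpanSingleton ℝ E v) 0 (1 : ℝ)
  rwa [LinearMap.toSpanSingleton_apply, one_smul] at h

/-- By homogeneity c(1) = n c(1/n) is itself a difference quotient of c at 0 for every n ≥ 1, so the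
constant c(1) converges to v. -/
theorem HasDirDeriv.eq_of_forall_natCast_mul {E : Type*} [AddCommGroup E] [Module ℝ E]
    [TopologicalSpace E] [T2Space E] {c : ℝ → E} {v : E}
    (hmul : ∀ (n : ℕ) (t : ℝ), c (n * t) = (n : ℝ) • c t) (hc : HasDirDeriv ℝ c 0 1 v) :
    c 1 = v := by
  have hc0 : c 0 = 0 := by
    have := hmul 0 0
    rwa [Nat.cast_zero, zero_mul, zero_smul] at this
  have hlim : Tendsto (fun n : ℕ => ((n : ℝ) + 1)⁻¹) atTop (𝓝[≠] 0) := by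
    refine tendsto_nhdsWithin_iff.2 ⟨?_, Eventually.of_forall fun n => ?_⟩
    · simpa using tendsto_one_div_add_atTop_nhds_zero_nat (𝕜 := ℝ)
    · exact inv_ne_zero (Nat.cast_add_one_ne_zero n)
  have h1 := Tendsto.comp hc hlim
  refine tendsto_nhds_unique (tendsto_const_nhds.congr fun n => ?_) h1
  have h2 := hmul (n + 1) ((n : ℝ) + 1)⁻¹
  rw [Nat.cast_succ, mul_inv_cancel₀ (Nat.cast_add_one_ne_zero n)] at h2
  rw [Function.comp_apply, inv_inv, hc0, sub_zero, zero_add, smul_eq_mul, mul_one]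
  exact h2

namespace IsConnectedHopfGrading

variable {𝕜 : Type*} [RCLike 𝕜] {H : Type*} [Ring H] [HopfAlgebra 𝕜 H]
  {𝒜 : ℕ → Submodule 𝕜 H} (h𝒜 : IsConnectedHopfGrading 𝒜)
  {B : Type*} [CommRing B] [Algebra 𝕜 B] [TopologicalSpace B] [IsTopologicalRing B]

theorem charExpHomeomorph_symm_inv (ψ : InfChar 𝕜 H B) :
    h𝒜.charExpHomeomorph.symm (h𝒜.charExpHomeomorph ψ)⁻¹ = -ψ := by
  rw [Homeomorph.symm_apply_eq]
  exact (h𝒜.charExp_neg ψ).symm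

theorem continuousMul_charGroup:
    Continuous fun p : CharGroup 𝕜 H B × CharGroup 𝕜 H B => p.1 * p.2 := by
  rw [CharGroup.isInducing_coe.continuous_iff, continuous_pi_iff]
  have h1 : ∀ h : H, Continuous fun φ : CharGroup 𝕜 H B => φ.ofConv h := fun h =>
    (continuous_apply h).comp CharGroup.isInducing_coe.continuous
  exact convMul_mem_subalgebra
    (S := (continuousSubalgebra : Subalgebra 𝕜 (CharGroup 𝕜 H B × CharGroup 𝕜 H B → B)))
    (f := fun p => WithConv.toConv p.1.ofConv.toLinearMap)
    (g := fun p => WithConv.toConv p.2.ofConv.toLinearMap)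
    (fun h => (h1 h).comp continuous_fst) (fun h => (h1 h).comp continuous_snd)

omit [IsTopologicalRing B] in
theorem continuousInv_charGroup : Continuous fun φ : CharGroup 𝕜 H B => φ⁻¹ := by
  rw [CharGroup.isInducing_coe.continuous_iff, continuous_pi_iff]
  exact fun h => (continuous_apply (HopfAlgebra.antipode 𝕜 h)).comp
    CharGroup.isInducing_coe.continuous

variable [Module ℝ B] [IsScalarTower ℝ 𝕜 B]

theorem isMfdMapOn_charExpHomeomorph (r : WithTop ℕ∞) (U : Set (InfChar 𝕜 H B)) :
    IsMfdMapOn 𝕜 r (modelAtlas (InfChar 𝕜 H B))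
      {(h𝒜.charExpHomeomorph (B := B)).symm.toOpenPartialHomeomorph} h𝒜.charExpHomeomorph U := by
  refine ⟨h𝒜.charExpHomeomorph.continuous.continuousOn, ?_⟩
  rintro _ rfl _ rfl
  have h1 : (h𝒜.charExpHomeomorph (B := B)).symm.toOpenPartialHomeomorph ∘
      h𝒜.charExpHomeomorph ∘ (OpenPartialHomeomorph.refl (InfChar 𝕜 H B)).symm =
      ContinuousLinearMap.id 𝕜 (InfChar 𝕜 H B) := by
    ext1 ψ
    exact h𝒜.charExpHomeomorph.symm_apply_apply ψ
  rw [h1]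
  exact ContinuousLinearMap.isOfClassOn _ _ _

theorem isMfdMapOn_charExpHomeomorph_symm (r : WithTop ℕ∞) (U : Set (CharGroup 𝕜 H B)) :
    IsMfdMapOn 𝕜 r {(h𝒜.charExpHomeomorph (B := B)).symm.toOpenPartialHomeomorph}
      (modelAtlas (InfChar 𝕜 H B)) h𝒜.charExpHomeomorph.symm U := by
  refine ⟨h𝒜.charExpHomeomorph.symm.continuous.continuousOn, ?_⟩
  rintro _ rfl _ rfl
  have h1 : OpenPartialHomeomorph.refl (InfChar 𝕜 H B) ∘ h𝒜.charExpHomeomorph.symm ∘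
      (h𝒜.charExpHomeomorph (B := B)).symm.toOpenPartialHomeomorph.symm =
      ContinuousLinearMap.id 𝕜 (InfChar 𝕜 H B) := by
    ext1 ψ
    exact h𝒜.charExpHomeomorph.symm_apply_apply ψ
  rw [h1]
  exact ContinuousLinearMap.isOfClassOn _ _ _

theorem isMfdLocalDiffeoAt_charExpHomeomorph (r : WithTop ℕ∞) (ψ : InfChar 𝕜 H B) :
    IsMfdLocalDiffeoAt 𝕜 r (modelAtlas (InfChar 𝕜 H B))
      {(h𝒜.charExpHomeomorph (B := B)).symm.toOpenPartialHomeomorph} h𝒜.charExpHomeomorph ψ :=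
  ⟨h𝒜.charExpHomeomorph.toOpenPartialHomeomorph, trivial, fun _ _ => rfl,
    h𝒜.isMfdMapOn_charExpHomeomorph r _, h𝒜.isMfdMapOn_charExpHomeomorph_symm r _⟩

theorem charExpHomeomorph_add_real_smul (ψ : InfChar 𝕜 H B) (s t : ℝ) :
    h𝒜.charExpHomeomorph ((s + t) • ψ) =
      h𝒜.charExpHomeomorph (s • ψ) * h𝒜.charExpHomeomorph (t • ψ) := by
  rw [← algebraMap_smul 𝕜 (s + t) ψ, ← algebraMap_smul 𝕜 s ψ, ← algebraMap_smul 𝕜 t ψ, map_add]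
  exact h𝒜.charExp_add_smul ψ _ _

variable [ContinuousSMul 𝕜 B] [T2Space B] [ContinuousSMul ℝ B] [LocallyConvexSpace ℝ B]

theorem isLCAtlas_charExpHomeomorph (r : WithTop ℕ∞) :
    IsLCAtlas 𝕜 r {(h𝒜.charExpHomeomorph (B := B)).symm.toOpenPartialHomeomorph} where
  isTopologicalAddGroup_model := inferInstance
  continuousSMul_model := inferInstance
  locallyConvexSpace_model := InfChar.locallyConvexSpace
  t2Space_model := inferInstance
  t2Space := inferInstance
  covers := fun x => ⟨_, rfl, trivial⟩
  compatible := by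
    rintro _ rfl _ rfl
    have h1 : (h𝒜.charExpHomeomorph (B := B)).symm.toOpenPartialHomeomorph ∘
        (h𝒜.charExpHomeomorph (B := B)).symm.toOpenPartialHomeomorph.symm =
        ContinuousLinearMap.id 𝕜 (InfChar 𝕜 H B) := by
      ext1 ψ
      exact h𝒜.charExpHomeomorph.symm_apply_apply ψ
    rw [h1]
    exact ContinuousLinearMap.isOfClassOn _ _ _

theorem isLCLieGroup_charExpHomeomorph (r : WithTop ℕ∞) :
    IsLCLieGroup 𝕜 r {(h𝒜.charExpHomeomorph (B := B)).symm.toOpenPartialHomeomorph} where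
  isLCAtlas := h𝒜.isLCAtlas_charExpHomeomorph r
  mul := by
    refine ⟨continuousMul_charGroup.continuousOn, ?_⟩
    rintro _ ⟨_, rfl, _, rfl, rfl⟩ _ rfl
    -- In the chart, multiplication is by definition the Baker-Campbell-Hausdorff product.
    exact h𝒜.isOfClassOn_bch _
  inv := by
    refine ⟨continuousInv_charGroup.continuousOn, ?_⟩
    rintro _ rfl _ rfl
    have h1 : (h𝒜.charExpHomeomorph (B := B)).symm.toOpenPartialHomeomorph ∘
        (fun x : CharGroup 𝕜 H B => x⁻¹) ∘
        (h𝒜.charExpHomeomorph (B := B)).symm.toOpenPartialHomeomorph.symm =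
        fun ψ => -ψ := by
      ext1 ψ
      exact h𝒜.charExpHomeomorph_symm_inv ψ
    rw [h1]
    exact isOfClassOn_neg _ _

omit [ContinuousSMul 𝕜 B] [T2Space B] [LocallyConvexSpace ℝ B] in
theorem isOneParamSubgroup_charExpHomeomorph (ψ : InfChar 𝕜 H B) :
    IsOneParamSubgroup {(h𝒜.charExpHomeomorph (B := B)).symm.toOpenPartialHomeomorph}
      h𝒜.charExpHomeomorph.symm.toOpenPartialHomeomorph
      (fun t : ℝ => h𝒜.charExpHomeomorph (t • ψ)) ψ := by
  have h1 : (h𝒜.charExpHomeomorph (B := B)).symm.toOpenPartialHomeomorph ∘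
      (fun t : ℝ => h𝒜.charExpHomeomorph (t • ψ)) =
      ContinuousLinearMap.toSpanSingleton ℝ ψ := by
    ext1 t
    exact h𝒜.charExpHomeomorph.symm_apply_apply (t • ψ)
  refine ⟨⟨?_, ?_⟩, h𝒜.charExpHomeomorph_add_real_smul ψ, ?_⟩
  · exact (h𝒜.charExpHomeomorph.continuous.comp
      (continuous_id.smul continuous_const)).continuousOn
  · rintro _ rfl _ rfl
    rw [← Function.comp_assoc, h1]
    exact ContinuousLinearMap.isOfClassOn _ _ _
  · rw [h1]
    exact HasDirDeriv.smul_const ψ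

omit [ContinuousSMul 𝕜 B] [ContinuousSMul ℝ B] [LocallyConvexSpace ℝ B] in
-- Since γ(n t) = γ(t)^n and exp(n x) = exp(x)^n, the curve c = log ∘ γ satisfies c(n t) = n c(t).
-- With c'(0) = ψ this forces c(1) = ψ.
theorem eq_of_isOneParamSubgroup {ψ : InfChar 𝕜 H B} {γ : ℝ → CharGroup 𝕜 H B}
    (hγ : IsOneParamSubgroup {(h𝒜.charExpHomeomorph (B := B)).symm.toOpenPartialHomeomorph}
      h𝒜.charExpHomeomorph.symm.toOpenPartialHomeomorph γ ψ) :
    γ 1 = h𝒜.charExpHomeomorph ψ := by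
  rw [← Homeomorph.symm_apply_eq]
  set c : ℝ → InfChar 𝕜 H B := fun t => h𝒜.charExpHomeomorph.symm (γ t)
  have hγ0 : γ 0 = 1 := by
    have := hγ.map_add 0 0
    rwa [add_zero, left_eq_mul] at this
  have hpow : ∀ (n : ℕ) (t : ℝ), γ (n * t) = γ t ^ n := by
    intro n t
    induction n with
    | zero => rw [Nat.cast_zero, zero_mul, pow_zero, hγ0]
    | succ n ih => rw [Nat.cast_succ, add_mul, one_mul, hγ.map_add, ih, pow_succ]
  have hmul : ∀ (n : ℕ) (t : ℝ), c (n * t) = (n : ℝ) • c t := by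
    intro n t
    have h1 := h𝒜.charExp_nat_smul (c t) n
    have h2 : h𝒜.charExp (c t) = γ t := h𝒜.charExpHomeomorph.apply_symm_apply (γ t)
    rw [h2, ← hpow] at h1
    rw [← algebraMap_smul 𝕜 (n : ℝ) (c t), map_natCast]
    exact (Homeomorph.symm_apply_eq _).2 h1.symm
  exact HasDirDeriv.eq_of_forall_natCast_mul hmul hγ.deriv_zero

omit [ContinuousSMul 𝕜 B] [LocallyConvexSpace ℝ B] in
theorem isLieExp_charExpHomeomorph :
    IsLieExp {(h𝒜.charExpHomeomorph (B := B)).symm.toOpenPartialHomeomorph}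
      h𝒜.charExpHomeomorph.symm.toOpenPartialHomeomorph h𝒜.charExpHomeomorph :=
  fun ψ => ⟨⟨_, h𝒜.isOneParamSubgroup_charExpHomeomorph ψ⟩,
    fun _ hγ => h𝒜.eq_of_isOneParamSubgroup hγ⟩

theorem isBCHLieGroup_charExpHomeomorph :
    IsBCHLieGroup 𝕜 {(h𝒜.charExpHomeomorph (B := B)).symm.toOpenPartialHomeomorph} where
  smooth := h𝒜.isLCLieGroup_charExpHomeomorph ∞
  analytic := h𝒜.isLCLieGroup_charExpHomeomorph ω
  exp := by
    rintro _ rfl _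
    exact ⟨h𝒜.charExpHomeomorph, h𝒜.isLieExp_charExpHomeomorph,
      h𝒜.isMfdMapOn_charExpHomeomorph ∞ univ, h𝒜.isMfdLocalDiffeoAt_charExpHomeomorph ∞ 0,
      h𝒜.isMfdLocalDiffeoAt_charExpHomeomorph ω 0⟩

end IsConnectedHopfGrading

theorem continuousSMul_real_of_isScalarTower (𝕜 B : Type*) [RCLike 𝕜] [AddCommGroup B]
    [Module 𝕜 B] [Module ℝ B] [IsScalarTower ℝ 𝕜 B] [TopologicalSpace B] [ContinuousSMul 𝕜 B] :
    ContinuousSMul ℝ B where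
  continuous_smul := by
    have h1 : Continuous fun p : ℝ × B => algebraMap ℝ 𝕜 p.1 • p.2 :=
      ((continuous_algebraMap ℝ 𝕜).comp continuous_fst).smul continuous_snd
    simpa only [algebraMap_smul] using h1

theorem mainTheorem3 {𝕜 : Type*} [RCLike 𝕜] {H : Type*} [Ring H] [HopfAlgebra 𝕜 H]
    (𝒜 : ℕ → Submodule 𝕜 H) (h𝒜 : IsConnectedHopfGrading 𝒜)
    {B : Type*} [CommRing B] [Algebra 𝕜 B] [Module ℝ B] [IsScalarTower ℝ 𝕜 B]
    [TopologicalSpace B] [IsTopologicalRing B] [ContinuousSMul 𝕜 B] [LocallyConvexSpace ℝ B]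
    [T2Space B] :
    ∃ Φ : InfChar 𝕜 H B ≃ₜ CharGroup 𝕜 H B,
      (∀ (ψ : InfChar 𝕜 H B) (h : H),
        HasSum (fun k : ℕ => (k.factorial : 𝕜)⁻¹ • (WithConv.toConv (ψ : H →ₗ[𝕜] B) ^ k) h)
          (Φ ψ h)) ∧
      IsBCHLieGroup 𝕜 {Φ.symm.toOpenPartialHomeomorph} ∧
      IsLieExp {Φ.symm.toOpenPartialHomeomorph} Φ.symm.toOpenPartialHomeomorph Φ ∧
      IsMfdDiffeo 𝕜 ω (modelAtlas (InfChar 𝕜 H B)) {Φ.symm.toOpenPartialHomeomorph} Φ := by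
  have := continuousSMul_real_of_isScalarTower 𝕜 B
  exact ⟨h𝒜.charExpHomeomorph, h𝒜.hasSum_charExp, h𝒜.isBCHLieGroup_charExpHomeomorph,
    h𝒜.isLieExp_charExpHomeomorph, h𝒜.charExpHomeomorph.symm,
    h𝒜.charExpHomeomorph.left_inv, h𝒜.charExpHomeomorph.right_inv,
    h𝒜.isMfdMapOn_charExpHomeomorph ω univ, h𝒜.isMfdMapOn_charExpHomeomorph_symm ω univ⟩
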